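/- Let $\mathbb X\subset\mathbb R^n$ be Lebesgue measurable and let $(X_t)$ be a Markov process on $\mathbb X$ with transition densities $p^t:\mathbb X\times\mathbb X\to[0,\infty)$, $t>0$, having a unique stationary probability measure $\mu$; $\mu$ has a continuous, strictly positive Lebesgue density $\pi$ and detailed balance $p^t(x,y)\pi(x)=p^t(y,x)\pi(y)$ holds. Let $0\le r\le n$, let $\mathbb Z\subset\mathbb R^r$ be a domain (any Borel set is allowed) and let $\xi:\mathbb X\to\mathbb Z$ be a reaction coordinate which is $C^1$ on a neighbourhood of $\mathbb X$ and whose gradient $\nabla\xi\in\mathbb R^{n\times r}$ has full rank at almost every point of $\mathbb X$. On the level set $\Sigma_\xi(z)=\{x\in\mathbb X:\xi(x)=z\}$ let $$d\mu_z(x)=\pi(x)\,\det\big(\nabla\xi(x)^{\top}\nabla\xi(x)\big)^{-1/2}\,dH_{n-r}(x),$$ where $H_{n-r}$ is the $(n-r)$-dimensional Hausdorff measure (points where the determinant vanishes get weight $0$). Let $\lambda$ be Lebesgue measure on $\mathbb X$, $|\mathbb Z|$ the Lebesgue measure of $\mathbb Z$, $\tau>0$ a lag time and $\varepsilon\ge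 0$. For a function $q:\mathbb Z\times\mathbb X\to[0,\infty)$, with $(x,y)\mapsto q(\xi(x),y)$ measurable with respect to $\mu\times\lambda$, condition $(\mathrm L)$ at time $t$ is $$\frac1{|\mathbb Z|}\int_{\mathbb X}\int_{\mathbb X}\big|p^t(x,y)-q(\xi(x),y)\big|\,dy\,d\mu(x)\le\varepsilon .$$ The system is $\varepsilon$-lumpable with respect to $\xi$ if there are functions $p_L^t$ such that $(\mathrm L)$ holds with $q=p_L^t$ for all $t\ge\tau$. It is differentially $\varepsilon$-lumpable with respect to $\xi$ if $$\frac1{|\mathbb Z|}\int_{\mathbb Z}\int_{\Sigma_\xi(z)}\int_{\Sigma_\xi(z)}\big\|p^\tau(x^{(1)},\cdot)-p^\tau(x^{(2)},\cdot)\big\|_{L^1}\,d\mu_z(x^{(1)})\,d\mu_z(x^{(2)})\,dz\le\varepsilon .\tag{L$'$}$$ **Lemma.** (a) Suppose that $\mu_z$ is a probability measure for almost every $z\in\mathbb Z$. If the system is $\varepsilon$-lumpable with respect to $\xi$ (it suffices that $(\mathrm L)$ holds at $t=\tau$ for some $q$), then it is differentially $2\varepsilon$-lumpable with respect to $\xi$.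 Conversely, if it is differentially $\varepsilon$-lumpable with respect to $\xi$, then it is $\varepsilon$-lumpable with respect to $\xi$, with $$p_L^t(z,\cdot)=\int_{\Sigma_\xi(z)}p^t(x',\cdot)\,d\mu_z(x')\qquad(t\ge\tau).$$ (b) Without the supposition on $\mu_z$, both implications hold if in $(\mathrm L')$ the inner integral over $x^{(1)}$ and in $p_L^t$ the integral over $x'$ are replaced by averages, that is, by integrals with respect to the normalized measure $\mu_z/\mu_z(\Sigma_\xi(z))$. -/

import Mathlib

open MeasureTheory ProbabilityTheory
open scoped ENNReal Matrix

namespace ReactionCoordinate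

noncomputable section

/-- Lebesgue measure on a Lebesgue-measurable set `X ⊆ ℝⁿ`. -/
def leb {n : ℕ} (X : Set (EuclideanSpace ℝ (Fin n))) : Measure X :=
  Measure.comap Subtype.val volume

/-- The measure `dμ = π(x) dx` on `X`. -/
def densityMeasure {n : ℕ} {X : Set (EuclideanSpace ℝ (Fin n))} (dens : X → ℝ) : Measure X :=
  (leb X).withDensity fun x => ENNReal.ofReal (dens x)

/-- A time- and space-continuous Markov process on `X ⊆ ℝⁿ`, given by its transition
probability functions `P t` for `t > 0`. They have transition densities `p t`; the process has a
unique stationary probability measure, this measure has a continuous and strictly positive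
density `dens` (written `π` in the text), and detailed balance holds. -/
structure MarkovSystem {n : ℕ} (X : Set (EuclideanSpace ℝ (Fin n))) where
  P : ℝ → Kernel X X
  markov : ∀ t, 0 < t → IsMarkovKernel (P t)
  chapman_kolmogorov : ∀ s t, 0 < s → 0 < t → P (s + t) = P t ∘ₖ P s
  p : ℝ → X → X → ℝ
  p_measurable : ∀ t, 0 < t → Measurable fun w : X × X => p t w.1 w.2
  p_nonneg : ∀ t, 0 < t → ∀ x y, 0 ≤ p t x y
  p_density : ∀ t, 0 < t → ∀ x,
    P t x = (leb X).withDensity fun y => ENNReal.ofReal (p t x y)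
  dens : X → ℝ
  dens_continuous : Continuous dens
  dens_pos : ∀ x, 0 < dens x
  prob : IsProbabilityMeasure (densityMeasure dens)
  stationary : ∀ t, 0 < t → (P t).Invariant (densityMeasure dens)
  stationary_unique : ∀ ν : Measure X, IsProbabilityMeasure ν →
    (∀ t, 0 < t → (P t).Invariant ν) → ν = densityMeasure dens
  detailed_balance : ∀ t, 0 < t → ∀ x y, p t x y * dens x = p t y x * dens y

/-- The stationary measure `μ`. -/
def MarkovSystem.mu {n : ℕ} {X : Set (EuclideanSpace ℝ (Fin n))} (S : MarkovSystem X) :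
    Measure X :=
  densityMeasure S.dens

/-- The matrix `∇ξ(x) ∈ ℝ^{n × r}`, whose columns are the gradients of the components of `ξ`. -/
def grad {n r : ℕ} (ξ : EuclideanSpace ℝ (Fin n) → EuclideanSpace ℝ (Fin r))
    (x : EuclideanSpace ℝ (Fin n)) : Matrix (Fin n) (Fin r) ℝ :=
  Matrix.of fun i j => (fderiv ℝ ξ x (EuclideanSpace.single i 1)) j

/-- `det (∇ξ(x)ᵀ ∇ξ(x))`. -/
def gramDet {n r : ℕ} (ξ : EuclideanSpace ℝ (Fin n) → EuclideanSpace ℝ (Fin r))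
    (x : EuclideanSpace ℝ (Fin n)) : ℝ :=
  ((grad ξ x)ᵀ * grad ξ x).det

/-- `ξ : X → Z` is a reaction coordinate for which `∇ξ` and the factor
`det (∇ξᵀ ∇ξ) ^ (-1/2)` make sense: `ξ` is continuously differentiable near `X`, and
`∇ξ` has full rank at almost every point of `X`. -/
structure IsReactionCoordinate {n r : ℕ} (X : Set (EuclideanSpace ℝ (Fin n)))
    (Z : Set (EuclideanSpace ℝ (Fin r)))
    (ξ : EuclideanSpace ℝ (Fin n) → EuclideanSpace ℝ (Fin r)) : Prop where
  mapsTo : Set.MapsTo ξ X Z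
  contDiffOn : ∃ U, IsOpen U ∧ X ⊆ U ∧ ContDiffOn ℝ 1 ξ U
  nondegenerate : ∀ᵐ x : X ∂leb X, gramDet ξ x ≠ 0

/-- The level set `Σ_ξ(z)`. -/
def levelSet {n r : ℕ} (X : Set (EuclideanSpace ℝ (Fin n)))
    (ξ : EuclideanSpace ℝ (Fin n) → EuclideanSpace ℝ (Fin r))
    (z : EuclideanSpace ℝ (Fin r)) : Set X :=
  {x | ξ x = z}

variable {n r : ℕ} {X : Set (EuclideanSpace ℝ (Fin n))}

/-- The marginal stationary measure `μ_z` on the level set `Σ_ξ(z)`, that is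
`π(x) det (∇ξ(x)ᵀ ∇ξ(x)) ^ (-1/2) dH_{n-r}(x)`, where `H_{n-r}` is the Hausdorff measure
(normalized to be Lebesgue measure on `ℝ^{n-r}`). Points where the determinant vanishes get
weight zero. -/
def MarkovSystem.levelMeasure (S : MarkovSystem X)
    (ξ : EuclideanSpace ℝ (Fin n) → EuclideanSpace ℝ (Fin r))
    (z : EuclideanSpace ℝ (Fin r)) : Measure X :=
  ((Measure.euclideanHausdorffMeasure (n - r) : Measure X).restrict
      (levelSet X ξ z)).withDensity
    fun x => ENNReal.ofReal (S.dens x * (Real.sqrt (gramDet ξ x))⁻¹)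

/-- `‖p^t(x₁, ·) - p^t(x₂, ·)‖` in `L¹(X)`. -/
def MarkovSystem.dist (S : MarkovSystem X) (t : ℝ) (x₁ x₂ : X) : ℝ≥0∞ :=
  eLpNorm (fun y => S.p t x₁ y - S.p t x₂ y) 1 (leb X)

/-- Condition (L) at time `t` with the effective density `q : Z × X → ℝ⁺`:
`|Z|⁻¹ ‖p^t(∗, ·) - q(ξ(∗), ·)‖_𝕂 ≤ ε`, where `𝕂 = L¹(μ × λ)`. -/
def MarkovSystem.IsLumpableWith (S : MarkovSystem X) (Z : Set (EuclideanSpace ℝ (Fin r)))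
    (ξ : EuclideanSpace ℝ (Fin n) → EuclideanSpace ℝ (Fin r)) (t ε : ℝ)
    (q : EuclideanSpace ℝ (Fin r) → X → ℝ) : Prop :=
  (∀ z ∈ Z, ∀ y, 0 ≤ q z y) ∧
  AEStronglyMeasurable (fun w : X × X => q (ξ w.1) w.2) (S.mu.prod (leb X)) ∧
  (volume Z)⁻¹ *
    eLpNorm (fun w : X × X => S.p t w.1 w.2 - q (ξ w.1) w.2) 1 (S.mu.prod (leb X))
      ≤ ENNReal.ofReal ε

/-- Condition (L) at the single time `t`, for some effective density. -/
def MarkovSystem.IsLumpableAt (S : MarkovSystem X) (Z : Set (EuclideanSpace ℝ (Fin r)))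
    (ξ : EuclideanSpace ℝ (Fin n) → EuclideanSpace ℝ (Fin r)) (t ε : ℝ) : Prop :=
  ∃ q, S.IsLumpableWith Z ξ t ε q

/-- `ε`-lumpability with lag time `τ` through the family `q t` of effective densities:
condition (L) holds for all `t ≥ τ`. -/
def MarkovSystem.IsLumpableThrough (S : MarkovSystem X) (Z : Set (EuclideanSpace ℝ (Fin r)))
    (ξ : EuclideanSpace ℝ (Fin n) → EuclideanSpace ℝ (Fin r)) (τ ε : ℝ)
    (q : ℝ → EuclideanSpace ℝ (Fin r) → X → ℝ) : Prop :=
  ∀ t, τ ≤ t → S.IsLumpableWith Z ξ t ε (q t)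

/-- `ε`-lumpability with respect to `ξ`, with lag time `τ`. -/
def MarkovSystem.IsLumpable (S : MarkovSystem X) (Z : Set (EuclideanSpace ℝ (Fin r)))
    (ξ : EuclideanSpace ℝ (Fin n) → EuclideanSpace ℝ (Fin r)) (τ ε : ℝ) : Prop :=
  ∃ q, S.IsLumpableThrough Z ξ τ ε q

theorem MarkovSystem.IsLumpable.isLumpableAt {S : MarkovSystem X}
    {Z : Set (EuclideanSpace ℝ (Fin r))}
    {ξ : EuclideanSpace ℝ (Fin n) → EuclideanSpace ℝ (Fin r)} {τ ε : ℝ}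
    (h : S.IsLumpable Z ξ τ ε) : S.IsLumpableAt Z ξ τ ε :=
  h.elim fun q hq => ⟨q τ, hq τ le_rfl⟩

/-- Differential `ε`-lumpability with respect to `ξ`, with lag time `τ`:
`|Z|⁻¹ ∫_Z ∫ ∫ ‖p^τ(x₁, ·) - p^τ(x₂, ·)‖_{L¹} dμ_z(x₁) dμ_z(x₂) dz ≤ ε`. -/
def MarkovSystem.IsDifferentiallyLumpable (S : MarkovSystem X)
    (Z : Set (EuclideanSpace ℝ (Fin r)))
    (ξ : EuclideanSpace ℝ (Fin n) → EuclideanSpace ℝ (Fin r)) (τ ε : ℝ) : Prop :=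
  (volume Z)⁻¹ *
    ∫⁻ z in Z, ∫⁻ x₂, ∫⁻ x₁, S.dist τ x₁ x₂ ∂(S.levelMeasure ξ z) ∂(S.levelMeasure ξ z)
      ≤ ENNReal.ofReal ε

/-- The form of differential `ε`-lumpability for marginal measures `μ_z` of arbitrary total
mass: the inner integral is the average over the level set, that is the integral with respect to
the probability measure `μ_z / μ_z(Σ_ξ(z))`. -/
def MarkovSystem.IsDifferentiallyLumpableAvg (S : MarkovSystem X)
    (Z : Set (EuclideanSpace ℝ (Fin r)))
    (ξ : EuclideanSpace ℝ (Fin n) → EuclideanSpace ℝ (Fin r)) (τ ε : ℝ) : Prop :=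
  (volume Z)⁻¹ *
    ∫⁻ z in Z, ∫⁻ x₂, ⨍⁻ x₁, S.dist τ x₁ x₂ ∂(S.levelMeasure ξ z) ∂(S.levelMeasure ξ z)
      ≤ ENNReal.ofReal ε

end

end ReactionCoordinate

/-! ### The coarea formula for linear maps -/

section LinearCoarea

open Module LinearMap Measure

variable {E F : Type*} [NormedAddCommGroup E] [InnerProductSpace ℝ E] [FiniteDimensional ℝ E]
  [NormedAddCommGroup F] [InnerProductSpace ℝ F] [FiniteDimensional ℝ F]

/-! By the coarea formula the measures μ_z disintegrate μ, that is ∫∫ G dμ_z dz = ∫ G dμ, because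
det(∇ξᵀ∇ξ)^(-1/2) is the reciprocal of the coarea factor. So (L) becomes an integral over z and over
the level set of z, on which q(ξ(x), ·) is the single function q(z, ·).

From (L) to (L'): on a level set the triangle inequality through q(z, ·) gives ‖p^τ(x₁, ·) - p^τ(x₂,
·)‖ ≤ f(x₁) + f(x₂), with f(x) the distance from p^τ(x, ·) to q(z, ·). Averaging over x₁ and
integrating over x₂ turns each summand into ∫ f dμ_z; hence the factor 2
(`lintegral_laverage_le_two_mul`).

From (L') to (L): the distance from p^t(x₂, ·) to an average is at most the average distance
(`lintegral_enorm_sub_average_le`), and the distances at time t ≥ τ are bounded by those at τ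
because the transition operators contract L¹ (`MarkovSystem.dist_antitone`). The averaged density is
jointly measurable once z ↦ μ_z is replaced, off a null set, by a kernel
(`IsDisintegration.exists_kernel`). For probability measures averages are integrals, so (a) follows
from (b).

The coarea formula is Fubini's theorem for a surjective linear map. Near a regular point a map that
is almost isometric carries the fibres of a C¹ map to those of its derivative, so the formula holds
up to a factor c > 1. Summing over countably many pieces and letting c tend to 1 gives it exactly
(`coarea_of_regular`). -/

theorem LinearMap.normDet_adjoint_of_equiv (M : E ≃ₗ[ℝ] F) :
    (LinearMap.adjoint (M : E →ₗ[ℝ] F)).normDet = (M : E →ₗ[ℝ] F).normDet := by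
  rw [← sq_eq_sq₀ (normDet_nonneg _) (normDet_nonneg _)]
  have h1 := normDet_sq (LinearMap.adjoint (M : E →ₗ[ℝ] F))
  have h2 := normDet_sq (M : E →ₗ[ℝ] F)
  simp only [RCLike.ofReal_real_eq_id, id_eq, LinearMap.adjoint_adjoint] at h1 h2
  -- The squares are the determinants of M M* and M* M, which are conjugate through M.
  rw [h1, h2, ← LinearMap.det_conj _ M]
  congr 1
  ext x
  simp

/-- The coarea factor of a surjective linear map is the determinant of its restriction to the
orthogonal complement of the kernel. -/
theorem LinearMap.normDet_adjoint_eq_domRestrict (L : E →ₗ[ℝ] F)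
    (hL : Function.Surjective L) :
    (LinearMap.adjoint L).normDet = (L.domRestrict L.kerᗮ).normDet := by
  have hinj : (L.domRestrict L.kerᗮ).ker = ⊥ := by
    rw [LinearMap.ker_eq_bot']
    rintro ⟨w, hw⟩ h
    have hw' : w ∈ L.ker := by simpa using h
    have := Submodule.inner_right_of_mem_orthogonal hw' hw
    simpa using this
  have hsurj : Function.Surjective (L.domRestrict L.kerᗮ) := by
    intro z
    obtain ⟨x, rfl⟩ := hL z
    obtain ⟨y, hy, w, hw, rfl⟩ := L.ker.exists_add_mem_mem_orthogonal x
    exact ⟨⟨w, hw⟩, by simp [show L y = 0 from hy]⟩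
  let M : L.kerᗮ ≃ₗ[ℝ] F := LinearEquiv.ofBijective (L.domRestrict L.kerᗮ)
    ⟨LinearMap.ker_eq_bot.1 hinj, hsurj⟩
  have hM : (M : L.kerᗮ →ₗ[ℝ] F) = L.domRestrict L.kerᗮ := by ext; rfl
  rw [← hM, ← LinearMap.normDet_adjoint_of_equiv]
  -- The adjoint of `L` takes values in the orthogonal complement of the kernel; regarded as a map
  -- into it, it is the adjoint of the restriction of `L`.
  have hmem : ∀ z, LinearMap.adjoint L z ∈ L.kerᗮ := by
    intro z
    rw [Submodule.mem_orthogonal]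
    intro u hu
    rw [LinearMap.adjoint_inner_right, show L u = 0 from hu, inner_zero_left]
  rw [← LinearMap.normDet_codRestrict hmem]
  congr 1
  rw [hM]
  refine LinearMap.ext fun z => ?_
  refine ext_inner_left ℝ fun w => ?_
  rw [LinearMap.adjoint_inner_right]
  rw [Submodule.coe_inner]
  simp [LinearMap.adjoint_inner_right]

variable [MeasurableSpace E] [BorelSpace E] [MeasurableSpace F] [BorelSpace F]

/-- The coarea formula for a surjective linear map. -/
theorem LinearMap.coarea (L : E →ₗ[ℝ] F) (hL : Function.Surjective L) {C : Set E}
    (hC : MeasurableSet C) :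
    Measurable (fun z => (μHE[finrank ℝ E - finrank ℝ F] : Measure E) (C ∩ L ⁻¹' {z})) ∧
    ∫⁻ z, (μHE[finrank ℝ E - finrank ℝ F] : Measure E) (C ∩ L ⁻¹' {z}) =
      ENNReal.ofReal (LinearMap.adjoint L).normDet * volume C := by
  set K := L.ker
  have hk : finrank ℝ E - finrank ℝ F = finrank ℝ K := by
    have := L.finrank_range_add_finrank_ker
    rw [LinearMap.range_eq_top.2 hL, finrank_top] at this
    change _ + finrank ℝ K = _ at this
    omega
  have hr : finrank ℝ Kᗮ = finrank ℝ F := by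
    have := L.finrank_range_add_finrank_ker
    rw [LinearMap.range_eq_top.2 hL, finrank_top] at this
    change _ + finrank ℝ K = _ at this
    have := K.finrank_add_finrank_orthogonal
    omega
  have hinj : Function.Injective (L.domRestrict Kᗮ) := by
    rw [← LinearMap.ker_eq_bot, LinearMap.ker_eq_bot']
    rintro ⟨w, hw⟩ h
    have hw' : w ∈ K := by simpa [K] using h
    have := Submodule.inner_right_of_mem_orthogonal hw' hw
    simpa using this
  let M : Kᗮ ≃L[ℝ] F := (LinearEquiv.ofInjectiveOfFinrankEq (L.domRestrict Kᗮ) hinj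
    hr).toContinuousLinearEquiv
  have hM : ∀ w : Kᗮ, M w = L w := fun w => rfl
  -- The fibre over `M w` is the translate of `K` by `w`, so its Hausdorff measure is the volume of
  -- a slice in `K × Kᗮ`, and Fubini applies.
  have hfib : ∀ w : Kᗮ, (μHE[finrank ℝ E - finrank ℝ F] : Measure E) (C ∩ L ⁻¹' {M w}) =
      volume ((fun u : K => (u, w)) ⁻¹' ((K.measurableEquivProd (0 : E)).symm ⁻¹' C)) := by
    intro w
    have hiso : Isometry (fun u : K => (u : E) + w) :=
      Isometry.of_dist_eq fun a b => by simp [dist_add_right, Subtype.dist_eq]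
    have h1 : (fun u : K => (u, w)) ⁻¹' ((K.measurableEquivProd (0 : E)).symm ⁻¹' C)
        = (fun u : K => (u : E) + w) ⁻¹' C := by
      ext u; simp
    rw [h1, ← InnerProductSpace.euclideanHausdorffMeasure_eq_volume,
      hiso.euclideanHausdorffMeasure_preimage, hk]
    congr 2
    ext x
    simp only [Set.mem_preimage, Set.mem_singleton_iff, Set.mem_range, Subtype.exists, hM]
    constructor
    · intro h
      exact ⟨x - w, by simp [K, h], by simp⟩
    · rintro ⟨u, hu, rfl⟩
      simp [show L u = 0 from hu]
  have hmC : MeasurableSet ((K.measurableEquivProd (0 : E)).symm ⁻¹' C) :=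
    (K.measurableEquivProd (0 : E)).symm.measurable hC
  have hmeas : Measurable (fun w : Kᗮ =>
      (μHE[finrank ℝ E - finrank ℝ F] : Measure E) (C ∩ L ⁻¹' {M w})) := by
    simp_rw [hfib]
    exact measurable_measure_prodMk_right hmC
  have hvol : ∫⁻ w : Kᗮ, (μHE[finrank ℝ E - finrank ℝ F] : Measure E) (C ∩ L ⁻¹' {M w})
      = volume C := by
    simp_rw [hfib]
    rw [← Measure.prod_apply_symm hmC, ← Measure.volume_eq_prod,
      (K.measurePreserving_measurableEquivProd (0 : E)).symm.measure_preimage_equiv,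
      InnerProductSpace.euclideanHausdorffMeasure_eq_volume]
  have hme : Measurable (fun z => (μHE[finrank ℝ E - finrank ℝ F] : Measure E) (C ∩ L ⁻¹' {z})) := by
    have := hmeas.comp M.symm.continuous.measurable
    simpa [Function.comp_def] using this
  refine ⟨hme, ?_⟩
  have hmap : (volume : Measure F) =
      ENNReal.ofReal (LinearMap.adjoint L).normDet • (volume : Measure Kᗮ).map M := by
    ext s hs
    rw [Measure.smul_apply, Measure.map_apply M.continuous.measurable hs, smul_eq_mul,
      L.normDet_adjoint_eq_domRestrict hL,
      ← LinearMap.euclideanHausdorffMeasure_image_eq_normDet_mul_volume, hr,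
      InnerProductSpace.euclideanHausdorffMeasure_eq_volume]
    congr 1
    exact (Set.image_preimage_eq s M.surjective).symm
  rw [hmap, lintegral_smul_measure, lintegral_map hme M.continuous.measurable, hvol, smul_eq_mul]

end LinearCoarea

/-! ### The coarea formula for C¹ maps on regular points -/

section Coarea

open Module LinearMap Measure Set Filter Topology
open scoped NNReal

section Lipschitz

variable {X Y : Type*} [EMetricSpace X] [MeasurableSpace X] [BorelSpace X]
  [EMetricSpace Y] [MeasurableSpace Y] [BorelSpace Y]

theorem LipschitzOnWith.euclideanHausdorffMeasure_image_le {K : ℝ≥0} {f : X → Y} {s : Set X}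
    (h : LipschitzOnWith K f s) (d : ℕ) :
    (μHE[d] : Measure Y) (f '' s) ≤ (K : ℝ≥0∞) ^ d * (μHE[d] : Measure X) s := by
  simp only [euclideanHausdorffMeasure_def, Measure.smul_apply, ENNReal.smul_def, smul_eq_mul]
  rw [mul_left_comm]
  gcongr
  simpa using h.hausdorffMeasure_image_le (d := d) (by positivity)

theorem LipschitzOnWith.le_euclideanHausdorffMeasure_image {K : ℝ≥0} {f : X → Y} {s : Set X}
    (h : ∀ x ∈ s, ∀ y ∈ s, edist x y ≤ K * edist (f x) (f y)) (d : ℕ) :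
    (μHE[d] : Measure X) s ≤ (K : ℝ≥0∞) ^ d * (μHE[d] : Measure Y) (f '' s) := by
  rcases isEmpty_or_nonempty X with hX | hX
  · simp [Set.eq_empty_of_isEmpty s]
  have hinj : InjOn f s := by
    intro x hx y hy hxy
    have := h x hx y hy
    rw [hxy, edist_self, mul_zero] at this
    exact edist_le_zero.1 this
  have h' : LipschitzOnWith K (Function.invFunOn f s) (f '' s) := by
    rintro _ ⟨x, hx, rfl⟩ _ ⟨y, hy, rfl⟩
    rw [hinj.leftInvOn_invFunOn hx, hinj.leftInvOn_invFunOn hy]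
    exact h x hx y hy
  have := h'.euclideanHausdorffMeasure_image_le d
  rwa [hinj.leftInvOn_invFunOn.image_image] at this

end Lipschitz

section

variable {E F : Type*} [NormedAddCommGroup E] [NormedAddCommGroup F]

theorem measurableSet_inter_fiber [MeasurableSpace E] [BorelSpace E] {ξ : E → F} {U B : Set E} (hξ : ContinuousOn ξ U)
    (hB : MeasurableSet B) (hBU : B ⊆ U) (z : F) : MeasurableSet (B ∩ ξ ⁻¹' {z}) := by
  obtain ⟨u, hu, hu'⟩ := continuousOn_iff_isClosed.1 (hξ.mono hBU) {z} isClosed_singleton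
  rw [inter_comm, hu']
  exact hu.measurableSet.inter hB

variable [NormedSpace ℝ E] [NormedSpace ℝ F]

/-- When `R` is a right inverse of `L`, composing this map with `L` gives `ξ` up to a constant, so
it straightens the fibres of `ξ` into those of `L`. The correction to the identity has Lipschitz
constant at most `‖R‖ δ`, so distances change by a factor near 1. -/
theorem ApproximatesLinearOn.straightening {ξ : E → F} {L : E →L[ℝ] F} {R : F →L[ℝ] E} {B : Set E}
    {δ : ℝ≥0} (h : ApproximatesLinearOn ξ L B δ) {c₁ : ℝ≥0} (hδ : 1 + ‖R‖₊ * δ ≤ c₁)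
    (hδ' : 1 ≤ c₁ * (1 - ‖R‖₊ * δ)) (x₀ : E) :
    LipschitzOnWith c₁ (fun x => x + R (ξ x - ξ x₀ - L (x - x₀))) B ∧
    ∀ x ∈ B, ∀ y ∈ B, edist x y ≤ c₁ * edist (x + R (ξ x - ξ x₀ - L (x - x₀)))
      (y + R (ξ y - ξ x₀ - L (y - x₀))) := by
  have key : ∀ x ∈ B, ∀ y ∈ B, ‖R (ξ x - ξ y - L (x - y))‖ ≤ ‖R‖ * δ * ‖x - y‖ := fun x hx y hy =>
    (R.le_opNorm _).trans (by rw [mul_assoc]; gcongr; exact h x hx y hy)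
  have hsub : ∀ x y, x + R (ξ x - ξ x₀ - L (x - x₀)) - (y + R (ξ y - ξ x₀ - L (y - x₀))) =
      (x - y) + R (ξ x - ξ y - L (x - y)) := by
    intro x y
    simp only [map_sub]
    abel
  constructor
  · refine LipschitzOnWith.of_dist_le_mul fun x hx y hy => ?_
    rw [dist_eq_norm, dist_eq_norm, hsub]
    have : ((1 + ‖R‖₊ * δ : ℝ≥0) : ℝ) ≤ c₁ := by exact_mod_cast hδ
    push_cast at this
    calc _ ≤ ‖x - y‖ + ‖R‖ * δ * ‖x - y‖ := (norm_add_le _ _).trans (by grw [key x hx y hy])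
      _ = (1 + ‖R‖ * δ) * ‖x - y‖ := by ring
      _ ≤ _ := by gcongr
  · intro x hx y hy
    rw [edist_nndist, edist_nndist]
    norm_cast
    rw [← NNReal.coe_le_coe]
    push_cast
    rw [dist_eq_norm, dist_eq_norm, hsub]
    -- Subtraction in `ℝ≥0` is truncated; otherwise `hδ'` would read `1 ≤ 0`.
    have hδ₁ : ‖R‖₊ * δ ≤ 1 := by
      by_contra hcon
      rw [tsub_eq_zero_of_le (not_le.1 hcon).le, mul_zero] at hδ'
      exact absurd hδ' (by norm_num)
    have h1 : (1 : ℝ) ≤ c₁ * (1 - ‖R‖ * δ) := by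
      have := NNReal.coe_le_coe.2 hδ'
      rw [NNReal.coe_mul, NNReal.coe_sub hδ₁] at this
      simpa using this
    have h2 : (1 - ‖R‖ * δ) * ‖x - y‖ ≤ ‖(x - y) + R (ξ x - ξ y - L (x - y))‖ := by
      have h3 := key x hx y hy
      have h4 : ‖x - y‖ ≤ ‖(x - y) + R (ξ x - ξ y - L (x - y))‖ + ‖R (ξ x - ξ y - L (x - y))‖ := by
        simpa using norm_sub_le ((x - y) + R (ξ x - ξ y - L (x - y))) (R (ξ x - ξ y - L (x - y)))
      linarith
    calc ‖x - y‖ ≤ c₁ * (1 - ‖R‖ * δ) * ‖x - y‖ := le_mul_of_one_le_left (norm_nonneg _) h1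
      _ ≤ _ := by rw [mul_assoc]; gcongr

end

variable {E F : Type*} [NormedAddCommGroup E] [InnerProductSpace ℝ E] [FiniteDimensional ℝ E]
  [NormedAddCommGroup F] [InnerProductSpace ℝ F] [FiniteDimensional ℝ F]

/-- The coarea factor `√det (L Lᵀ)` of a linear map `L`. -/
noncomputable def LinearMap.coareaFactor (L : E →L[ℝ] F) : ℝ :=
  (LinearMap.adjoint (L : E →ₗ[ℝ] F)).normDet

theorem LinearMap.coareaFactor_nonneg (L : E →L[ℝ] F) : 0 ≤ coareaFactor L := normDet_nonneg _

theorem LinearMap.coareaFactor_eq_sqrt (L : E →L[ℝ] F) :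
    coareaFactor L = √((L : E →ₗ[ℝ] F) ∘ₗ LinearMap.adjoint (L : E →ₗ[ℝ] F)).det := by
  have h := normDet_sq (LinearMap.adjoint (L : E →ₗ[ℝ] F))
  simp only [RCLike.ofReal_real_eq_id, id_eq, LinearMap.adjoint_adjoint] at h
  rw [← h, Real.sqrt_sq (normDet_nonneg _), coareaFactor]

theorem LinearMap.continuous_coareaFactor : Continuous (coareaFactor : (E →L[ℝ] F) → ℝ) := by
  have : (coareaFactor : (E →L[ℝ] F) → ℝ) =
      fun L => √(L ∘L ContinuousLinearMap.adjoint L).det := by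
    ext L
    rw [coareaFactor_eq_sqrt]
    rfl
  rw [this]
  refine Real.continuous_sqrt.comp (ContinuousLinearMap.continuous_det.comp ?_)
  exact continuous_id.clm_comp (ContinuousLinearMap.adjoint (𝕜 := ℝ) (E := E) (F := F)).continuous

theorem LinearMap.surjective_of_coareaFactor_ne_zero {L : E →L[ℝ] F} (h : coareaFactor L ≠ 0) :
    Function.Surjective L := by
  have h1 : (LinearMap.adjoint (L : E →ₗ[ℝ] F)).ker = ⊥ :=
    ((normDet_ne_zero_tfae _).out 0 1).1 h
  have h2 := LinearMap.orthogonal_ker (LinearMap.adjoint (L : E →ₗ[ℝ] F))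
  rw [h1, Submodule.bot_orthogonal_eq_top, LinearMap.adjoint_adjoint] at h2
  exact LinearMap.range_eq_top.1 h2.symm

variable [MeasurableSpace E] [BorelSpace E] [MeasurableSpace F] [BorelSpace F]

/-- The integral of the reciprocal coarea factor over the part of a fibre of `ξ` in `B`. -/
noncomputable def fiberIntegral (ξ : E → F) (B : Set E) (z : F) : ℝ≥0∞ :=
  ∫⁻ x in B ∩ ξ ⁻¹' {z}, ENNReal.ofReal (coareaFactor (fderiv ℝ ξ x))⁻¹
    ∂(μHE[finrank ℝ E - finrank ℝ F] : Measure E)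

/-- `B` satisfies the coarea formula for `ξ` up to a factor `c`. -/
def AlmostCoarea (ξ : E → F) (c : ℝ≥0∞) (B : Set E) : Prop :=
  ∃ h : F → ℝ≥0∞, Measurable h ∧ (∀ z, fiberIntegral ξ B z ≤ c * h z) ∧
    (∀ z, h z ≤ c * fiberIntegral ξ B z) ∧ volume B ≤ c * ∫⁻ z, h z ∧ ∫⁻ z, h z ≤ c * volume B

/-- The linear formula is exact on `φ '' B`. Passing back to `B` costs one factor `c₁` for each
dimension of a fibre or of the space, and one more for the varying coarea factor; hence the exponent
`d + 1`. -/
theorem almostCoarea_of_straightening {ξ : E → F} {L : E →L[ℝ] F} (hL : coareaFactor L ≠ 0)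
    {B : Set E} (hB : MeasurableSet B) (φ : E → E) (a : F) (hφ : ∀ x, L (φ x) = ξ x - a)
    (hφc : ContinuousOn φ B) (hξ : ContinuousOn ξ B) {c c₁ : ℝ≥0}
    (hc : ∀ d ≤ finrank ℝ E, c₁ ^ (d + 1) ≤ c)
    (h₁ : LipschitzOnWith c₁ φ B)
    (h₂ : ∀ x ∈ B, ∀ y ∈ B, edist x y ≤ c₁ * edist (φ x) (φ y))
    (h₃ : ∀ x ∈ B, ENNReal.ofReal (coareaFactor (fderiv ℝ ξ x))⁻¹ ≤
      c₁ * ENNReal.ofReal (coareaFactor L)⁻¹)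
    (h₄ : ∀ x ∈ B, ENNReal.ofReal (coareaFactor L)⁻¹ ≤
      c₁ * ENNReal.ofReal (coareaFactor (fderiv ℝ ξ x))⁻¹) (hc₁ : 1 ≤ c₁) :
    AlmostCoarea ξ c B := by
  set k := finrank ℝ E - finrank ℝ F with hk
  have hinj : InjOn φ B := by
    intro x hx y hy hxy
    have := h₂ x hx y hy
    rw [hxy, edist_self, mul_zero] at this
    exact edist_le_zero.1 this
  have hC : MeasurableSet (φ '' B) := hB.image_of_continuousOn_injOn hφc hinj
  have hcE : ∀ d ≤ finrank ℝ E, (c₁ : ℝ≥0∞) ^ (d + 1) ≤ c := fun d hd => by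
    exact_mod_cast hc d hd
  have hcE' : ∀ d ≤ finrank ℝ E, (c₁ : ℝ≥0∞) ^ d ≤ c := fun d hd =>
    (pow_le_pow_right₀ (by exact_mod_cast hc₁) (Nat.le_succ d)).trans (hcE d hd)
  obtain ⟨hm, hint⟩ := (L : E →ₗ[ℝ] F).coarea (surjective_of_coareaFactor_ne_zero hL) hC
  have hfib : ∀ z, φ '' B ∩ L ⁻¹' {z - a} = φ '' (B ∩ ξ ⁻¹' {z}) := by
    intro z
    ext y
    constructor
    · rintro ⟨⟨x, hx, rfl⟩, hy⟩
      refine ⟨x, ⟨hx, ?_⟩, rfl⟩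
      simpa [hφ] using hy
    · rintro ⟨x, ⟨hx, hxz⟩, rfl⟩
      refine ⟨⟨x, hx, rfl⟩, ?_⟩
      simpa [hφ] using hxz
  set j := ENNReal.ofReal (coareaFactor L)⁻¹ with hj
  have hBz : ∀ z, MeasurableSet (B ∩ ξ ⁻¹' {z}) := measurableSet_inter_fiber hξ hB subset_rfl
  have hup : ∀ z, fiberIntegral ξ B z ≤ c₁ * (j * (μHE[k] : Measure E) (B ∩ ξ ⁻¹' {z})) := by
    intro z
    rw [← mul_assoc, ← setLIntegral_const]
    exact setLIntegral_mono' (hBz z) fun x hx => h₃ x hx.1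
  have hlow : ∀ z, j * (μHE[k] : Measure E) (B ∩ ξ ⁻¹' {z}) ≤ c₁ * fiberIntegral ξ B z := by
    intro z
    rw [fiberIntegral, ← setLIntegral_const, ← lintegral_const_mul' _ _ ENNReal.coe_ne_top]
    exact setLIntegral_mono' (hBz z) fun x hx => h₄ x hx.1
  have hvol : ∫⁻ z, j * (μHE[k] : Measure E) (φ '' (B ∩ ξ ⁻¹' {z})) = volume (φ '' B) := by
    simp_rw [← hfib]
    rw [lintegral_sub_right_eq_self (μ := volume)
      (fun z => j * (μHE[k] : Measure E) (φ '' B ∩ L ⁻¹' {z})) a,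
      lintegral_const_mul j (by exact hm)]
    refine (congrArg _ hint).trans ?_
    rw [← mul_assoc, hj, ← ENNReal.ofReal_mul (inv_nonneg.2 (coareaFactor_nonneg L))]
    change ENNReal.ofReal ((coareaFactor L)⁻¹ * coareaFactor L) * _ = _
    rw [inv_mul_cancel₀ hL, ENNReal.ofReal_one, one_mul]
  have hkE : k ≤ finrank ℝ E := Nat.sub_le _ _
  -- The comparison function is the fibre integral of the linear model on `φ '' B`, shifted by `a`;
  -- its measurability comes from the linear case.
  refine ⟨fun z => j * (μHE[k] : Measure E) (φ '' (B ∩ ξ ⁻¹' {z})), ?_, ?_, ?_, ?_, ?_⟩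
  · simp_rw [← hfib]
    exact (hm.comp (measurable_id.sub_const a)).const_mul j
  · intro z
    refine (hup z).trans ?_
    have := LipschitzOnWith.le_euclideanHausdorffMeasure_image
      (fun x hx y hy => h₂ x hx.1 y hy.1 : ∀ x ∈ B ∩ ξ ⁻¹' {z}, ∀ y ∈ B ∩ ξ ⁻¹' {z}, _) k
    calc _ ≤ c₁ * (j * (c₁ ^ k * (μHE[k] : Measure E) (φ '' (B ∩ ξ ⁻¹' {z})))) := by gcongr
      _ = c₁ ^ (k + 1) * (j * (μHE[k] : Measure E) (φ '' (B ∩ ξ ⁻¹' {z}))) := by ring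
      _ ≤ _ := by gcongr; exact hcE k hkE
  · intro z
    have := (h₁.mono (inter_subset_left (t := ξ ⁻¹' {z}))).euclideanHausdorffMeasure_image_le k
    calc _ ≤ j * (c₁ ^ k * (μHE[k] : Measure E) (B ∩ ξ ⁻¹' {z})) := mul_le_mul_right this j
      _ = c₁ ^ k * (j * (μHE[k] : Measure E) (B ∩ ξ ⁻¹' {z})) := by ring
      _ ≤ c₁ ^ k * (c₁ * fiberIntegral ξ B z) := mul_le_mul_right (hlow z) _
      _ = c₁ ^ (k + 1) * fiberIntegral ξ B z := by ring
      _ ≤ _ := by gcongr; exact hcE k hkE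
  · rw [hvol, ← InnerProductSpace.euclideanHausdorffMeasure_eq_volume]
    refine (LipschitzOnWith.le_euclideanHausdorffMeasure_image h₂ _).trans ?_
    gcongr
    exact hcE' _ le_rfl
  · rw [hvol, ← InnerProductSpace.euclideanHausdorffMeasure_eq_volume]
    refine (h₁.euclideanHausdorffMeasure_image_le _).trans ?_
    gcongr
    exact hcE' _ le_rfl

theorem exists_nhds_almostCoarea {ξ : E → F} {U : Set E} (hU : IsOpen U) (hξ : ContDiffOn ℝ 1 ξ U)
    {x₀ : E} (hx₀ : x₀ ∈ U) (hreg : coareaFactor (fderiv ℝ ξ x₀) ≠ 0) {c : ℝ≥0} (hc : 1 < c) :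
    ∃ W, IsOpen W ∧ x₀ ∈ W ∧ W ⊆ U ∧ ∀ B ⊆ W, MeasurableSet B → AlmostCoarea ξ c B := by
  set L := fderiv ℝ ξ x₀ with hLdef
  obtain ⟨R, hR⟩ : ∃ R : F →L[ℝ] E, ∀ z, L (R z) = z := by
    obtain ⟨R, hR⟩ := (L : E →ₗ[ℝ] F).exists_rightInverse_of_surjective
      (LinearMap.range_eq_top.2 (surjective_of_coareaFactor_ne_zero hreg))
    exact ⟨R.toContinuousLinearMap, fun z => LinearMap.congr_fun hR z⟩
  obtain ⟨c₁, hc₁, hc₁c⟩ : ∃ c₁ : ℝ≥0, 1 < c₁ ∧ c₁ ^ (finrank ℝ E + 1) ≤ c := by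
    have h1 : Tendsto (fun t : ℝ≥0 => t ^ (finrank ℝ E + 1)) (𝓝[>] 1) (𝓝 1) := by
      have : Continuous fun t : ℝ≥0 => t ^ (finrank ℝ E + 1) := by fun_prop
      simpa using (this.tendsto 1).mono_left nhdsWithin_le_nhds
    obtain ⟨t, h2, h3⟩ := ((h1.eventually_le_const hc).and self_mem_nhdsWithin).exists
    exact ⟨t, h3, h2⟩
  obtain ⟨δ, hδpos, hδ, hδ'⟩ : ∃ δ : ℝ≥0, 0 < δ ∧ 1 + ‖R‖₊ * δ ≤ c₁ ∧
      1 ≤ c₁ * (1 - ‖R‖₊ * δ) := by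
    have h1 : Tendsto (fun t : ℝ≥0 => 1 + ‖R‖₊ * t) (𝓝[>] 0) (𝓝 1) := by
      have : Continuous fun t : ℝ≥0 => 1 + ‖R‖₊ * t := by fun_prop
      simpa using (this.tendsto 0).mono_left nhdsWithin_le_nhds
    have h2 : Tendsto (fun t : ℝ≥0 => c₁ * (1 - ‖R‖₊ * t)) (𝓝[>] 0) (𝓝 c₁) := by
      have : Continuous fun t : ℝ≥0 => c₁ * (1 - ‖R‖₊ * t) := by fun_prop
      simpa using (this.tendsto 0).mono_left nhdsWithin_le_nhds
    obtain ⟨t, ⟨h3, h4⟩, h5⟩ := (((h1.eventually_le_const hc₁).and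
      (h2.eventually_const_le hc₁)).and self_mem_nhdsWithin).exists
    exact ⟨t, h5, h3, h4⟩
  have hcd : ContDiffAt ℝ 1 ξ x₀ := hξ.contDiffAt (hU.mem_nhds hx₀)
  have hstrict : HasStrictFDerivAt ξ L x₀ := hcd.hasStrictFDerivAt (by norm_num)
  obtain ⟨V, hV, happ⟩ := hstrict.approximates_deriv_on_nhds (c := δ) (Or.inr hδpos)
  have hcont : ContinuousAt (fun x => coareaFactor (fderiv ℝ ξ x)) x₀ :=
    continuous_coareaFactor.continuousAt.comp
      (hcd.continuousAt_fderiv (by norm_num))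
  have hJ : 0 < coareaFactor L := lt_of_le_of_ne (coareaFactor_nonneg L) hreg.symm
  have hinv : ContinuousAt (fun x => (coareaFactor (fderiv ℝ ξ x))⁻¹) x₀ := hcont.inv₀ hreg
  have hc₁R : (1 : ℝ) < c₁ := by exact_mod_cast hc₁
  have hJ' : 0 < (coareaFactor L)⁻¹ := inv_pos.2 hJ
  have e1 : ∀ᶠ x in 𝓝 x₀, (coareaFactor (fderiv ℝ ξ x))⁻¹ ≤ c₁ * (coareaFactor L)⁻¹ :=
    hinv.eventually_le_const (lt_mul_of_one_lt_left hJ' hc₁R)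
  have e2 : ∀ᶠ x in 𝓝 x₀, (coareaFactor L)⁻¹ ≤ c₁ * (coareaFactor (fderiv ℝ ξ x))⁻¹ :=
    (hinv.const_mul (c₁ : ℝ)).eventually_const_le (lt_mul_of_one_lt_left hJ' hc₁R)
  obtain ⟨W, hWsub, hWo, hxW⟩ := mem_nhds_iff.1
    (inter_mem (inter_mem hV (hU.mem_nhds hx₀)) (e1.and e2))
  refine ⟨W, hWo, hxW, fun x hx => (hWsub hx).1.2, fun B hBW hB => ?_⟩
  obtain ⟨l1, l2⟩ := (happ.mono_set (fun x hx => (hWsub (hBW hx)).1.1)).straightening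
    hδ hδ' x₀ (R := R)
  refine almostCoarea_of_straightening hreg hB
    (fun x => x + R (ξ x - ξ x₀ - L (x - x₀))) (ξ x₀ - L x₀) ?_ l1.continuousOn
    (hξ.continuousOn.mono fun x hx => (hWsub (hBW hx)).1.2) ?_ l1 l2 ?_ ?_ hc₁.le
  · intro x
    rw [map_add, hR, map_sub]
    abel
  · exact fun d hd => (pow_le_pow_right₀ hc₁.le (by omega)).trans hc₁c
  · intro x hx
    rw [← ENNReal.ofReal_coe_nnreal, ← ENNReal.ofReal_mul (by positivity)]
    exact ENNReal.ofReal_le_ofReal (hWsub (hBW hx)).2.1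
  · intro x hx
    rw [← ENNReal.ofReal_coe_nnreal, ← ENNReal.ofReal_mul (by positivity)]
    exact ENNReal.ofReal_le_ofReal (hWsub (hBW hx)).2.2

/-- The defining inequalities add up over disjoint pieces with the same `c`, so a local estimate
becomes global without loss. -/
theorem AlmostCoarea.iUnion {ξ : E → F} {U : Set E} (hξ : ContinuousOn ξ U) {c : ℝ≥0∞}
    {B : ℕ → Set E} (hB : ∀ i, MeasurableSet (B i)) (hBU : ∀ i, B i ⊆ U)
    (hd : Pairwise (Function.onFun Disjoint B)) (h : ∀ i, AlmostCoarea ξ c (B i)) :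
    AlmostCoarea ξ c (⋃ i, B i) := by
  choose f hf h1 h2 h3 h4 using h
  have hfib : ∀ z, fiberIntegral ξ (⋃ i, B i) z = ∑' i, fiberIntegral ξ (B i) z := by
    intro z
    simp only [fiberIntegral, iUnion_inter]
    exact lintegral_iUnion (fun i => measurableSet_inter_fiber hξ (hB i) (hBU i) z)
      (fun i j hij => (hd hij).mono inter_subset_left inter_subset_left) _
  refine ⟨fun z => ∑' i, f i z, Measurable.tsum hf, fun z => ?_, fun z => ?_, ?_, ?_⟩
  · rw [hfib, ← ENNReal.tsum_mul_left]
    exact ENNReal.tsum_le_tsum fun i => h1 i z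
  · rw [hfib, ← ENNReal.tsum_mul_left]
    exact ENNReal.tsum_le_tsum fun i => h2 i z
  · rw [lintegral_tsum fun i => (hf i).aemeasurable, measure_iUnion hd hB,
      ← ENNReal.tsum_mul_left]
    exact ENNReal.tsum_le_tsum h3
  · rw [lintegral_tsum fun i => (hf i).aemeasurable, measure_iUnion hd hB,
      ← ENNReal.tsum_mul_left]
    exact ENNReal.tsum_le_tsum h4

theorem almostCoarea_empty (ξ : E → F) (c : ℝ≥0∞) : AlmostCoarea ξ c ∅ :=
  ⟨fun _ => 0, measurable_const, by simp [fiberIntegral], by simp, by simp, by simp⟩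

theorem almostCoarea_of_regular {ξ : E → F} {U : Set E} (hU : IsOpen U)
    (hξ : ContDiffOn ℝ 1 ξ U) {B : Set E} (hB : MeasurableSet B) (hBU : B ⊆ U)
    (hreg : ∀ x ∈ B, coareaFactor (fderiv ℝ ξ x) ≠ 0) {c : ℝ≥0} (hc : 1 < c) :
    AlmostCoarea ξ c B := by
  have hW : ∀ x, ∃ W, IsOpen W ∧ (x ∈ B → x ∈ W) ∧ W ⊆ U ∧
      ∀ B ⊆ W, MeasurableSet B → AlmostCoarea ξ c B := by
    intro x
    by_cases hx : x ∈ B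
    · obtain ⟨W, h1, h2, h3, h4⟩ := exists_nhds_almostCoarea hU hξ (hBU hx) (hreg x hx) hc
      exact ⟨W, h1, fun _ => h2, h3, h4⟩
    · refine ⟨∅, isOpen_empty, fun h => absurd h hx, empty_subset _, fun B hB _ => ?_⟩
      rw [subset_empty_iff.1 hB]
      exact almostCoarea_empty ξ c
  choose W hWo hWx hWU hW using hW
  -- By the Lindelöf property countably many neighbourhoods cover `B`; they are then made disjoint.
  obtain ⟨t, -, htc, ht⟩ := TopologicalSpace.countable_cover_nhdsWithin (f := W) (s := B)
    fun x hx => mem_nhdsWithin_of_mem_nhds ((hWo x).mem_nhds (hWx x hx))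
  obtain ⟨e, he⟩ := countable_iff_exists_subset_range.1 htc
  have hcov : B = ⋃ i, B ∩ disjointed (fun i => W (e i)) i := by
    rw [← inter_iUnion, iUnion_disjointed, eq_comm, inter_eq_left]
    refine ht.trans (iUnion₂_subset fun x hx => ?_)
    obtain ⟨i, rfl⟩ := he hx
    exact subset_iUnion (fun i => W (e i)) i
  have hm : ∀ i, MeasurableSet (B ∩ disjointed (fun i => W (e i)) i) := fun i =>
    hB.inter (MeasurableSet.disjointed (fun i => (hWo _).measurableSet) i)
  rw [hcov]
  refine AlmostCoarea.iUnion hξ.continuousOn hm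
    (fun i => inter_subset_left.trans hBU)
    (fun i j hij => (disjoint_disjointed _ hij).mono inter_subset_right inter_subset_right)
    (fun i => hW (e i) _ (inter_subset_right.trans (disjointed_subset _ i)) (hm i))

/-- The coarea formula for a continuously differentiable map, on a Borel set of regular points. -/
theorem coarea_of_regular {ξ : E → F} {U : Set E} (hU : IsOpen U)
    (hξ : ContDiffOn ℝ 1 ξ U) {B : Set E} (hB : MeasurableSet B) (hBU : B ⊆ U)
    (hreg : ∀ x ∈ B, coareaFactor (fderiv ℝ ξ x) ≠ 0) :
    Measurable (fiberIntegral ξ B) ∧ ∫⁻ z, fiberIntegral ξ B z = volume B := by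
  obtain ⟨c, -, hc1, hclim⟩ := exists_seq_strictAnti_tendsto (1 : ℝ≥0)
  have hcE : Tendsto (fun m => (c m : ℝ≥0∞)) atTop (𝓝 1) := by
    simpa using ENNReal.tendsto_coe.2 hclim
  have hmul : ∀ a : ℝ≥0∞, Tendsto (fun m => (c m : ℝ≥0∞) * a) atTop (𝓝 a) := fun a => by
    simpa using ENNReal.Tendsto.mul_const hcE (Or.inl one_ne_zero) (b := a)
  have hmul2 : ∀ a : ℝ≥0∞, Tendsto (fun m => (c m : ℝ≥0∞) * (c m * a)) atTop (𝓝 a) := fun a => by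
    have : Tendsto (fun m => (c m : ℝ≥0∞) * c m) atTop (𝓝 1) := by
      simpa using ENNReal.Tendsto.mul hcE (Or.inl one_ne_zero) hcE (Or.inl one_ne_zero)
    simpa [mul_assoc] using ENNReal.Tendsto.mul_const this (Or.inl one_ne_zero) (b := a)
  have hdiv : ∀ a : ℝ≥0∞, Tendsto (fun m => (c m : ℝ≥0∞)⁻¹ * a) atTop (𝓝 a) := fun a => by
    have : Tendsto (fun m => (c m : ℝ≥0∞)⁻¹) atTop (𝓝 1) := by
      simpa using tendsto_inv_iff.2 hcE
    simpa using ENNReal.Tendsto.mul_const this (Or.inl one_ne_zero) (b := a)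
  choose h hm h1 h2 h3 h4 using fun m => almostCoarea_of_regular hU hξ hB hBU hreg (hc1 m)
  -- Each `h m` lies between `(c m)⁻¹` and `c m` times the fibre integral. The limit `c m → 1`
  -- therefore yields the measurability of the fibre integral, not known beforehand.
  have hlim : Tendsto h atTop (𝓝 (fiberIntegral ξ B)) := by
    refine tendsto_pi_nhds.2 fun z => ?_
    refine tendsto_of_tendsto_of_tendsto_of_le_of_le (hdiv _) (hmul (fiberIntegral ξ B z))
      (fun m => ?_) (fun m => h2 m z)
    have hne : (c m : ℝ≥0∞) ≠ 0 := by exact_mod_cast (zero_lt_one.trans (hc1 m)).ne'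
    calc _ ≤ (c m : ℝ≥0∞)⁻¹ * (c m * h m z) := by gcongr; exact h1 m z
      _ = h m z := by rw [← mul_assoc, ENNReal.inv_mul_cancel hne ENNReal.coe_ne_top, one_mul]
  have hmeas : Measurable (fiberIntegral ξ B) := measurable_of_tendsto_metrizable hm hlim
  refine ⟨hmeas, le_antisymm ?_ ?_⟩
  · refine ge_of_tendsto' (hmul2 (volume B)) fun m => ?_
    calc _ ≤ ∫⁻ z, c m * h m z := lintegral_mono (h1 m)
      _ = c m * ∫⁻ z, h m z := lintegral_const_mul _ (hm m)
      _ ≤ _ := by gcongr; exact h4 m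
  · refine ge_of_tendsto' (hmul2 (∫⁻ z, fiberIntegral ξ B z)) fun m => (h3 m).trans ?_
    rw [← lintegral_const_mul _ hmeas]
    gcongr
    exact h2 m _

end Coarea

/-! ### The coarea formula on X and the disintegration of μ -/

namespace ReactionCoordinate

open Module LinearMap Measure Set

variable {n r : ℕ} {X : Set (EuclideanSpace ℝ (Fin n))}

/-- The columns of `grad ξ x` are the images of the standard basis under the adjoint derivative, so
∇ξᵀ∇ξ is their Gram matrix. -/
theorem sqrt_gramDet (ξ : EuclideanSpace ℝ (Fin n) → EuclideanSpace ℝ (Fin r))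
    (x : EuclideanSpace ℝ (Fin n)) : √(gramDet ξ x) = coareaFactor (fderiv ℝ ξ x) := by
  have h := normDet_sq_eq_det_gram
    (LinearMap.adjoint (fderiv ℝ ξ x : EuclideanSpace ℝ (Fin n) →ₗ[ℝ] EuclideanSpace ℝ (Fin r)))
    (EuclideanSpace.basisFun (Fin r) ℝ)
  simp only [RCLike.ofReal_real_eq_id, id_eq] at h
  have h2 : Matrix.gram ℝ (fun j => LinearMap.adjoint
      (fderiv ℝ ξ x : EuclideanSpace ℝ (Fin n) →ₗ[ℝ] EuclideanSpace ℝ (Fin r))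
      (EuclideanSpace.basisFun (Fin r) ℝ j)) = (grad ξ x)ᵀ * grad ξ x := by
    ext i j
    rw [Matrix.gram_apply, ← (EuclideanSpace.basisFun (Fin n) ℝ).sum_inner_mul_inner,
      Matrix.mul_apply]
    refine Finset.sum_congr rfl fun k _ => ?_
    rw [LinearMap.adjoint_inner_left, LinearMap.adjoint_inner_right]
    simp [grad, EuclideanSpace.inner_single_left, EuclideanSpace.inner_single_right]
  rw [h2] at h
  rw [gramDet, ← h, Real.sqrt_sq (normDet_nonneg _), coareaFactor]

theorem gramDet_nonneg (ξ : EuclideanSpace ℝ (Fin n) → EuclideanSpace ℝ (Fin r))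
    (x : EuclideanSpace ℝ (Fin n)) : 0 ≤ gramDet ξ x := by
  have := (Matrix.posSemidef_conjTranspose_mul_self (grad ξ x)).det_nonneg
  simpa [gramDet, Matrix.conjTranspose_eq_transpose_of_trivial] using this

theorem leb_apply (hX : NullMeasurableSet X volume) {s : Set X} (hs : MeasurableSet s) :
    leb X s = volume (Subtype.val '' s) :=
  comap_apply₀ _ _ Subtype.val_injective
    (fun _ h => MeasurableSet.nullMeasurableSet_subtype_coe hX h) hs.nullMeasurableSet

theorem sigmaFinite_leb (hX : NullMeasurableSet X volume) : SigmaFinite (leb X) := by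
  have h : (leb X).map Subtype.val = volume.restrict X := by
    ext s hs
    rw [Measure.map_apply measurable_subtype_coe hs, leb_apply hX (measurable_subtype_coe hs),
      Subtype.image_preimage_coe, Measure.restrict_apply hs, inter_comm]
  have : SigmaFinite ((leb X).map Subtype.val) := by rw [h]; infer_instance
  exact SigmaFinite.of_map _ measurable_subtype_coe.aemeasurable this

theorem IsReactionCoordinate.continuous_comp_coe {Z : Set (EuclideanSpace ℝ (Fin r))}
    {ξ : EuclideanSpace ℝ (Fin n) → EuclideanSpace ℝ (Fin r)} (hξ : IsReactionCoordinate X Z ξ) :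
    Continuous fun x : X => ξ x := by
  obtain ⟨U, -, hXU, hU⟩ := hξ.contDiffOn
  exact (hU.continuousOn.mono hXU).comp_continuous continuous_subtype_val fun x => x.2

theorem measurable_weight (ξ : EuclideanSpace ℝ (Fin n) → EuclideanSpace ℝ (Fin r)) :
    Measurable fun x => ENNReal.ofReal (√(gramDet ξ x))⁻¹ := by
  simp_rw [sqrt_gramDet]
  exact ((continuous_coareaFactor.measurable.comp (measurable_fderiv ℝ ξ)).inv).ennreal_ofReal

/-- The coarea formula for Borel subsets of `X`. -/
theorem IsReactionCoordinate.coarea_set (hX : NullMeasurableSet X volume)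
    {Z : Set (EuclideanSpace ℝ (Fin r))}
    {ξ : EuclideanSpace ℝ (Fin n) → EuclideanSpace ℝ (Fin r)} (hξ : IsReactionCoordinate X Z ξ)
    {A : Set X} (hA : MeasurableSet A) :
    AEMeasurable (fun z => ∫⁻ x in A ∩ levelSet X ξ z, ENNReal.ofReal (√(gramDet ξ x))⁻¹
      ∂(μHE[n - r] : Measure X)) ∧
    ∫⁻ z, ∫⁻ x in A ∩ levelSet X ξ z, ENNReal.ofReal (√(gramDet ξ x))⁻¹
      ∂(μHE[n - r] : Measure X) = leb X A := by
  obtain ⟨U, hUo, hXU, hU⟩ := hξ.contDiffOn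
  obtain ⟨B, hB, rfl⟩ := hA
  -- As `X` is only null-measurable, it is enclosed between Borel sets `Xi ⊆ X ⊆ Xo` with null
  -- difference. By the coarea formula almost every fibre integral over the difference vanishes.
  obtain ⟨Xi, hXi, hXim, hXiX⟩ := hX.exists_measurable_subset_ae_eq
  obtain ⟨Xo, hXo, hXom, hXoX⟩ := hX.exists_measurable_superset_ae_eq
  set w : EuclideanSpace ℝ (Fin n) → ℝ≥0∞ := fun x => ENNReal.ofReal (√(gramDet ξ x))⁻¹ with hw
  have hwm : Measurable w := measurable_weight ξ
  set R : Set (EuclideanSpace ℝ (Fin n)) := {x | x ∈ U ∧ √(gramDet ξ x) ≠ 0} with hR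
  have hRm : MeasurableSet R := by
    refine hUo.measurableSet.inter (MeasurableSet.compl ?_)
    simp_rw [sqrt_gramDet]
    exact (continuous_coareaFactor.measurable.comp (measurable_fderiv ℝ ξ))
      (measurableSet_singleton 0)
  have hco : ∀ C, MeasurableSet C → Measurable (fiberIntegral ξ (C ∩ R)) ∧
      ∫⁻ z, fiberIntegral ξ (C ∩ R) z = volume (C ∩ R) := fun C hC =>
    coarea_of_regular hUo hU (hC.inter hRm) (fun x hx => hx.2.1)
      (fun x hx => by rw [← sqrt_gramDet]; exact hx.2.2)
  have hfw : ∀ C z, fiberIntegral ξ C z =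
      ∫⁻ x in C ∩ ξ ⁻¹' {z}, w x ∂(μHE[n - r] : Measure (EuclideanSpace ℝ (Fin n))) := by
    intro C z
    simp only [fiberIntegral, hw, sqrt_gramDet, finrank_euclideanSpace_fin]
  have hCz : ∀ C, MeasurableSet C → ∀ z, MeasurableSet ((C ∩ R) ∩ ξ ⁻¹' {z}) := fun C hC z =>
    measurableSet_inter_fiber hU.continuousOn (hC.inter hRm) (fun x hx => hx.2.1) z
  have hlev : ∀ z, MeasurableSet (Subtype.val ⁻¹' B ∩ levelSet X ξ z) := fun z =>
    (measurable_subtype_coe hB).inter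
      (hξ.continuous_comp_coe.measurable (measurableSet_singleton z))
  have hsub : ∀ C, MeasurableSet C → ∀ z,
      ∫⁻ x : X, ((C ∩ R) ∩ ξ ⁻¹' {z}).indicator w x ∂(μHE[n - r] : Measure X) =
      ∫⁻ x in ((C ∩ R) ∩ ξ ⁻¹' {z}) ∩ X, w x
        ∂(μHE[n - r] : Measure (EuclideanSpace ℝ (Fin n))) := by
    intro C hC z
    rw [← lintegral_map (hwm.indicator (hCz C hC z)) measurable_subtype_coe,
      isometry_subtype_coe.map_euclideanHausdorffMeasure, lintegral_indicator (hCz C hC z),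
      Measure.restrict_restrict (hCz C hC z), Subtype.range_coe]
  have hlow : ∀ z, fiberIntegral ξ ((B ∩ Xi) ∩ R) z ≤
      ∫⁻ x in Subtype.val ⁻¹' B ∩ levelSet X ξ z, w x ∂(μHE[n - r] : Measure X) := by
    intro z
    have : ((B ∩ Xi) ∩ R) ∩ ξ ⁻¹' {z} = (((B ∩ Xi) ∩ R) ∩ ξ ⁻¹' {z}) ∩ X :=
      (inter_eq_left.2 fun x hx => hXi hx.1.1.2).symm
    rw [hfw, this, ← hsub _ (hB.inter hXim), ← lintegral_indicator (hlev z)]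
    refine lintegral_mono fun x => ?_
    classical
    simp only [indicator_apply]
    split_ifs with h1 h2
    · exact le_rfl
    · exact absurd ⟨h1.1.1.1, h1.2⟩ h2
    · exact zero_le
    · exact le_rfl
  have hup : ∀ z, ∫⁻ x in Subtype.val ⁻¹' B ∩ levelSet X ξ z, w x ∂(μHE[n - r] : Measure X) ≤
      fiberIntegral ξ ((B ∩ Xo) ∩ R) z := by
    intro z
    rw [hfw]
    refine le_trans ?_ (lintegral_mono_set (inter_subset_left (t := X)))
    rw [← hsub _ (hB.inter hXom), ← lintegral_indicator (hlev z)]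
    refine lintegral_mono fun x => ?_
    classical
    simp only [indicator_apply]
    split_ifs with h1 h2
    · exact le_rfl
    -- A critical point has weight zero, since `0⁻¹ = 0`.
    · have : √(gramDet ξ x) = 0 := by
        by_contra h
        exact h2 ⟨⟨⟨h1.1, hXo x.2⟩, hXU x.2, h⟩, h1.2⟩
      simp [hw, this]
    · exact zero_le
    · exact le_rfl
  have hdiff : ∀ᵐ z, fiberIntegral ξ ((B ∩ (Xo \ Xi)) ∩ R) z = 0 := by
    obtain ⟨h1, h2⟩ := hco (B ∩ (Xo \ Xi)) (hB.inter (hXom.diff hXim))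
    refine (lintegral_eq_zero_iff h1).1 (h2.trans ?_)
    refine measure_mono_null (fun x hx => hx.1.2) (t := Xo \ Xi) ?_
    exact (ae_le_set.1 (hXoX.trans hXiX.symm).le)
  have hae : (fun z => ∫⁻ x in Subtype.val ⁻¹' B ∩ levelSet X ξ z, w x ∂(μHE[n - r] : Measure X))
      =ᵐ[volume] fiberIntegral ξ ((B ∩ Xi) ∩ R) := by
    filter_upwards [hdiff] with z hz
    refine le_antisymm ((hup z).trans ?_) (hlow z)
    have : ((B ∩ Xo) ∩ R) ∩ ξ ⁻¹' {z} ⊆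
        (((B ∩ Xi) ∩ R) ∩ ξ ⁻¹' {z}) ∪ (((B ∩ (Xo \ Xi)) ∩ R) ∩ ξ ⁻¹' {z}) := by
      intro x hx
      by_cases h : x ∈ Xi
      · exact Or.inl ⟨⟨⟨hx.1.1.1, h⟩, hx.1.2⟩, hx.2⟩
      · exact Or.inr ⟨⟨⟨hx.1.1.1, hx.1.1.2, h⟩, hx.1.2⟩, hx.2⟩
    rw [hfw] at hz ⊢
    refine (lintegral_mono_set this).trans ((lintegral_union_le _ _ _).trans ?_)
    rw [hz, add_zero, hfw]
  obtain ⟨h1, h2⟩ := hco (B ∩ Xi) (hB.inter hXim)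
  refine ⟨⟨_, h1, hae⟩, ?_⟩
  rw [lintegral_congr_ae hae, h2, leb_apply hX (measurable_subtype_coe hB),
    Subtype.image_preimage_coe]
  have hnull : volume (X \ R) = 0 := by
    have h3 := hξ.nondegenerate
    rw [ae_iff] at h3
    refine measure_mono_null ?_ (le_zero_iff.1 ((le_comap_apply _ _ Subtype.val_injective
      (fun _ h => MeasurableSet.nullMeasurableSet_subtype_coe hX h) _).trans h3.le))
    rintro x ⟨hx, hxR⟩
    refine ⟨⟨x, hx⟩, fun h => hxR ⟨hXU hx, ?_⟩, rfl⟩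
    exact (Real.sqrt_pos.2 (lt_of_le_of_ne (gramDet_nonneg ξ x) (Ne.symm h))).ne'
  have hXR : (X ∩ R : Set _) =ᵐ[volume] X := by
    rw [← Set.sdiff_sdiff_right_self]
    exact sdiff_null_ae_eq_self hnull
  refine measure_congr ?_
  have h4 : (B ∩ Xi ∩ R : Set _) = B ∩ (Xi ∩ R) := inter_assoc _ _ _
  rw [h4, inter_comm X B]
  exact (Filter.EventuallyEq.refl _ B).inter
    ((hXiX.inter (Filter.EventuallyEq.refl _ R)).trans hXR)

/-- The coarea formula for functions on `X`. -/
theorem IsReactionCoordinate.coarea (hX : NullMeasurableSet X volume)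
    {Z : Set (EuclideanSpace ℝ (Fin r))}
    {ξ : EuclideanSpace ℝ (Fin n) → EuclideanSpace ℝ (Fin r)} (hξ : IsReactionCoordinate X Z ξ)
    {G : X → ℝ≥0∞} (hG : Measurable G) :
    AEMeasurable (fun z => ∫⁻ x in levelSet X ξ z, ENNReal.ofReal (√(gramDet ξ x))⁻¹ * G x
      ∂(μHE[n - r] : Measure X)) ∧
    ∫⁻ z, ∫⁻ x in levelSet X ξ z, ENNReal.ofReal (√(gramDet ξ x))⁻¹ * G x
      ∂(μHE[n - r] : Measure X) = ∫⁻ x, G x ∂leb X := by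
  have hwm : Measurable fun x : X => ENNReal.ofReal (√(gramDet ξ x))⁻¹ :=
    (measurable_weight ξ).comp measurable_subtype_coe
  have hadd : ∀ {f g : X → ℝ≥0∞}, Measurable f → ∀ z,
      ∫⁻ x in levelSet X ξ z, ENNReal.ofReal (√(gramDet ξ x))⁻¹ * (f + g) x
        ∂(μHE[n - r] : Measure X) =
      ∫⁻ x in levelSet X ξ z, ENNReal.ofReal (√(gramDet ξ x))⁻¹ * f x ∂(μHE[n - r] : Measure X) +
      ∫⁻ x in levelSet X ξ z, ENNReal.ofReal (√(gramDet ξ x))⁻¹ * g x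
        ∂(μHE[n - r] : Measure X) := by
    intro f g hf z
    refine Eq.trans ?_ (lintegral_add_left (hwm.mul hf) _)
    simp [mul_add]
  refine Measurable.ennreal_induction (motive := fun G => AEMeasurable (fun z =>
      ∫⁻ x in levelSet X ξ z, ENNReal.ofReal (√(gramDet ξ x))⁻¹ * G x
        ∂(μHE[n - r] : Measure X)) ∧
    ∫⁻ z, ∫⁻ x in levelSet X ξ z, ENNReal.ofReal (√(gramDet ξ x))⁻¹ * G x
      ∂(μHE[n - r] : Measure X) = ∫⁻ x, G x ∂leb X) ?_ ?_ ?_ hG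
  · intro c A hA
    obtain ⟨h1, h2⟩ := hξ.coarea_set hX hA
    have h3 : ∀ z, ∫⁻ x in levelSet X ξ z, ENNReal.ofReal (√(gramDet ξ x))⁻¹ *
        A.indicator (fun _ => c) x ∂(μHE[n - r] : Measure X) =
        c * ∫⁻ x in A ∩ levelSet X ξ z, ENNReal.ofReal (√(gramDet ξ x))⁻¹
          ∂(μHE[n - r] : Measure X) := by
      intro z
      rw [← Measure.restrict_restrict hA, ← lintegral_indicator hA, ← lintegral_const_mul _
        (hwm.indicator hA)]
      refine lintegral_congr fun x => ?_
      by_cases hx : x ∈ A <;> simp [hx, mul_comm]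
    simp_rw [h3]
    refine ⟨h1.const_mul c, ?_⟩
    rw [lintegral_const_mul'' _ h1, h2, lintegral_indicator hA, setLIntegral_const]
  · intro f g _ hf hg ihf ihg
    simp_rw [hadd hf]
    refine ⟨ihf.1.add ihg.1, ?_⟩
    rw [lintegral_add_left' ihf.1, ihf.2, ihg.2, ← lintegral_add_left hf]
    rfl
  · intro f hf hmono ih
    have h3 : ∀ z, ∫⁻ x in levelSet X ξ z, ENNReal.ofReal (√(gramDet ξ x))⁻¹ *
        (⨆ i, f i x) ∂(μHE[n - r] : Measure X) =
        ⨆ i, ∫⁻ x in levelSet X ξ z, ENNReal.ofReal (√(gramDet ξ x))⁻¹ * f i x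
          ∂(μHE[n - r] : Measure X) := by
      intro z
      simp_rw [ENNReal.mul_iSup]
      exact lintegral_iSup (fun i => hwm.mul (hf i))
        fun i j hij x => mul_le_mul_right (hmono hij x) _
    simp_rw [h3]
    refine ⟨.iSup fun i => (ih i).1, ?_⟩
    rw [lintegral_iSup' (fun i => (ih i).1), lintegral_iSup hf hmono]
    · simp_rw [(ih _).2]
    · exact .of_forall fun z i j hij => lintegral_mono fun x => mul_le_mul_right (hmono hij x) _

/-- The measures `μ_z` disintegrate `μ`. -/
theorem MarkovSystem.disintegration (hX : NullMeasurableSet X volume) (S : MarkovSystem X)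
    {Z : Set (EuclideanSpace ℝ (Fin r))}
    {ξ : EuclideanSpace ℝ (Fin n) → EuclideanSpace ℝ (Fin r)} (hξ : IsReactionCoordinate X Z ξ)
    {G : X → ℝ≥0∞} (hG : Measurable G) :
    AEMeasurable (fun z => ∫⁻ x, G x ∂S.levelMeasure ξ z) ∧
    ∫⁻ z, ∫⁻ x, G x ∂S.levelMeasure ξ z = ∫⁻ x, G x ∂S.mu := by
  have hd : Measurable fun x : X => ENNReal.ofReal (S.dens x) :=
    S.dens_continuous.measurable.ennreal_ofReal
  have hwm : Measurable fun x : X => ENNReal.ofReal (√(gramDet ξ x))⁻¹ :=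
    (measurable_weight ξ).comp measurable_subtype_coe
  have h1 : ∀ z, ∫⁻ x, G x ∂S.levelMeasure ξ z =
      ∫⁻ x in levelSet X ξ z, ENNReal.ofReal (√(gramDet ξ x))⁻¹ *
        (ENNReal.ofReal (S.dens x) * G x) ∂(μHE[n - r] : Measure X) := by
    intro z
    have : (fun x : X => ENNReal.ofReal (S.dens x * (√(gramDet ξ x))⁻¹)) =
        fun x : X => ENNReal.ofReal (√(gramDet ξ x))⁻¹ * ENNReal.ofReal (S.dens x) := by
      ext x
      rw [ENNReal.ofReal_mul (S.dens_pos x).le, mul_comm]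
    rw [MarkovSystem.levelMeasure, this]
    refine (lintegral_withDensity_eq_lintegral_mul _ (hwm.mul hd) hG).trans ?_
    simp [mul_assoc]
  simp_rw [h1]
  have h2 : ∫⁻ x, G x ∂S.mu = ∫⁻ x, ENNReal.ofReal (S.dens x) * G x ∂leb X := by
    rw [MarkovSystem.mu, densityMeasure, lintegral_withDensity_eq_lintegral_mul _ hd hG]
    rfl
  rw [h2]
  exact hξ.coarea hX (hd.mul hG)

theorem MarkovSystem.ae_levelMeasure (S : MarkovSystem X)
    {Z : Set (EuclideanSpace ℝ (Fin r))}
    {ξ : EuclideanSpace ℝ (Fin n) → EuclideanSpace ℝ (Fin r)} (hξ : IsReactionCoordinate X Z ξ)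
    (z : EuclideanSpace ℝ (Fin r)) : ∀ᵐ x : X ∂S.levelMeasure ξ z, ξ x = z :=
  (withDensity_absolutelyContinuous _ _).ae_le
    (ae_restrict_mem (hξ.continuous_comp_coe.measurable (measurableSet_singleton z)))

end ReactionCoordinate

/-! ### Abstract disintegrations -/

section Disintegration

open Measure Set

variable {Ω F : Type*} [MeasurableSpace Ω] [MeasurableSpace F]

/-- The measures `m z` on the fibres of `ξ` disintegrate `μ` over `ζ`. -/
structure IsDisintegration (ζ : Measure F) (μ : Measure Ω) (ξ : Ω → F) (m : F → Measure Ω) :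
    Prop where
  measurable : Measurable ξ
  ae_fiber : ∀ z, ∀ᵐ x ∂m z, ξ x = z
  aemeasurable_lintegral : ∀ G : Ω → ℝ≥0∞, Measurable G → AEMeasurable (fun z => ∫⁻ x, G x ∂m z) ζ
  lintegral_lintegral : ∀ G : Ω → ℝ≥0∞, Measurable G →
    ∫⁻ z, ∫⁻ x, G x ∂m z ∂ζ = ∫⁻ x, G x ∂μ

namespace IsDisintegration

variable {ζ : Measure F} {μ : Measure Ω} {ξ : Ω → F} {m : F → Measure Ω}

theorem ae_ae (h : IsDisintegration ζ μ ξ m) {p : Ω → Prop} (hp : ∀ᵐ x ∂μ, p x) :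
    ∀ᵐ z ∂ζ, ∀ᵐ x ∂m z, p x := by
  have hs := measurableSet_toMeasurable μ {x | ¬ p x}
  have h1 := h.lintegral_lintegral _ (measurable_one.indicator hs)
  simp only [lintegral_indicator_one hs, measure_toMeasurable] at h1
  have h2 := h.aemeasurable_lintegral _ (measurable_one.indicator hs)
  simp only [lintegral_indicator_one hs] at h2
  rw [ae_iff.1 hp, lintegral_eq_zero_iff' h2] at h1
  filter_upwards [h1] with z hz
  exact measure_mono_null (subset_toMeasurable μ _) hz

/-- The preimage of a `ζ`-null set is charged only by the `m z` with `z` in that set. This allows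
`m` to be modified on null sets of `z`. -/
theorem ae_comp (h : IsDisintegration ζ μ ξ m) {p : F → Prop} (hp : ∀ᵐ z ∂ζ, p z) :
    ∀ᵐ x ∂μ, p (ξ x) := by
  have hN := measurableSet_toMeasurable ζ {z | ¬ p z}
  have hs := h.measurable hN
  have h1 := h.lintegral_lintegral _ (measurable_one.indicator hs)
  simp only [lintegral_indicator_one hs] at h1
  refine measure_mono_null (fun x hx => subset_toMeasurable ζ _ hx) (h1.symm.trans ?_)
  have h2 : ∀ᵐ z ∂ζ, z ∉ toMeasurable ζ {z | ¬ p z} := by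
    rw [← measure_eq_zero_iff_ae_notMem, measure_toMeasurable]
    exact hp
  rw [lintegral_eq_zero_of_ae_eq_zero]
  filter_upwards [h2] with z hz
  refine measure_mono_null ?_ (h.ae_fiber z)
  intro x hx hxz
  exact hz (hxz ▸ hx)

theorem ae_isFiniteMeasure (h : IsDisintegration ζ μ ξ m) [IsFiniteMeasure μ] :
    ∀ᵐ z ∂ζ, IsFiniteMeasure (m z) := by
  have h1 := h.lintegral_lintegral _ measurable_one
  have h2 := h.aemeasurable_lintegral _ measurable_one
  simp only [Pi.one_apply, lintegral_one] at h1 h2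
  filter_upwards [ae_lt_top' h2 (h1.trans_ne (measure_ne_top _ _))] with z hz
  exact ⟨hz⟩

/-- A disintegration of a finite measure agrees almost everywhere with a kernel. -/
theorem exists_kernel (h : IsDisintegration ζ μ ξ m) [IsFiniteMeasure μ]
    [hc : MeasurableSpace.CountablyGenerated Ω] :
    ∃ κ : Kernel F Ω, (∀ z, IsFiniteMeasure (κ z)) ∧ ∀ᵐ z ∂ζ, m z = κ z := by
  classical
  obtain ⟨b, hbc, hb⟩ := hc.isCountablyGenerated
  set C := generateSetAlgebra b with hC
  have hCc : C.Countable := countable_generateSetAlgebra hbc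
  have hCg : ‹MeasurableSpace Ω› = .generateFrom C := by
    rw [hC, generateFrom_generateSetAlgebra_eq, hb]
  have hCm : ∀ s ∈ C, MeasurableSet s := fun s hs => by
    rw [hCg]; exact MeasurableSpace.measurableSet_generateFrom hs
  have hae : ∀ s ∈ C, AEMeasurable (fun z => m z s) ζ := fun s hs => by
    have := h.aemeasurable_lintegral _ (measurable_one.indicator (hCm s hs))
    simpa only [lintegral_indicator_one (hCm s hs)] using this
  -- Countability of the generating algebra gives one null set outside which every `z ↦ m z s`
  -- equals its measurable version; there the kernel is `m`, and on a measurable null set containing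
  -- the bad points it is 0.
  have hgood : ∀ᵐ z ∂ζ, IsFiniteMeasure (m z) ∧ ∀ s (hs : s ∈ C), m z s = (hae s hs).mk _ z :=
    h.ae_isFiniteMeasure.and ((ae_ball_iff hCc).2 fun s hs => (hae s hs).ae_eq_mk)
  set N := toMeasurable ζ {z | ¬ (IsFiniteMeasure (m z) ∧
    ∀ s (hs : s ∈ C), m z s = (hae s hs).mk _ z)} with hN
  have hNm : MeasurableSet N := measurableSet_toMeasurable _ _
  have hNgood : ∀ z ∉ N, IsFiniteMeasure (m z) ∧ ∀ s (hs : s ∈ C), m z s = (hae s hs).mk _ z := by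
    intro z hz
    by_contra hcon
    exact hz (subset_toMeasurable ζ _ hcon)
  let κ : F → Measure Ω := fun z => if z ∈ N then 0 else m z
  have hκf : ∀ z, IsFiniteMeasure (κ z) := by
    intro z
    by_cases hz : z ∈ N
    · simp only [κ, hz, if_true]; infer_instance
    · simp only [κ, hz, if_false]; exact (hNgood z hz).1
  have hκs : ∀ s ∈ C, Measurable fun z => κ z s := by
    intro s hs
    have : (fun z => κ z s) = Nᶜ.indicator ((hae s hs).mk _) := by
      ext z
      by_cases hz : z ∈ N
      · simp [κ, hz]
      · simp [κ, hz, (hNgood z hz).2 s hs]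
    rw [this]
    exact (hae s hs).measurable_mk.indicator hNm.compl
  have hsa : IsSetAlgebra C := isSetAlgebra_generateSetAlgebra
  have hκm : Measurable κ :=
    Measurable.measure_of_isPiSystem hCg hsa.isSetRing.isSetSemiring.isPiSystem hκs
      (hκs _ hsa.univ_mem)
  refine ⟨⟨κ, hκm⟩, hκf, ?_⟩
  have : ∀ᵐ z ∂ζ, z ∉ N := by
    rw [← measure_eq_zero_iff_ae_notMem, hN, measure_toMeasurable]
    exact hgood
  filter_upwards [this] with z hz
  simp [κ, hz]

end IsDisintegration

/-- With one average and one integral, `f x₁` and `f x₂` each contribute exactly `∫ f`, whatever the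
total mass of `m`. -/
theorem lintegral_laverage_le_two_mul {m : Measure Ω} [IsFiniteMeasure m] {d : Ω → Ω → ℝ≥0∞}
    {f : Ω → ℝ≥0∞} (hf : Measurable f) (h : ∀ᵐ x₂ ∂m, ∀ᵐ x₁ ∂m, d x₁ x₂ ≤ f x₁ + f x₂) :
    ∫⁻ x₂, ⨍⁻ x₁, d x₁ x₂ ∂m ∂m ≤ 2 * ∫⁻ x, f x ∂m := by
  rcases eq_or_ne m 0 with rfl | hm
  · simp
  have : NeZero m := ⟨hm⟩
  have h1 : ∀ᵐ x₂ ∂m, ⨍⁻ x₁, d x₁ x₂ ∂m ≤ (⨍⁻ x₁, f x₁ ∂m) + f x₂ := by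
    filter_upwards [h] with x₂ hx₂
    rw [laverage, laverage]
    calc _ ≤ ∫⁻ x₁, (f x₁ + f x₂) ∂((m univ)⁻¹ • m) :=
          lintegral_mono_ae (Measure.ae_smul_measure hx₂ _)
      _ = _ := by rw [lintegral_add_left hf, lintegral_const,
        measure_univ (μ := (m univ)⁻¹ • m), mul_one]
  calc _ ≤ ∫⁻ x₂, ((⨍⁻ x₁, f x₁ ∂m) + f x₂) ∂m := lintegral_mono_ae h1
    _ = _ := by
      rw [lintegral_add_left measurable_const, lintegral_const, mul_comm, measure_mul_laverage,
        two_mul]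

end Disintegration

/-! ### Averages of transition densities -/

section Average

open Measure Set

variable {Ω Y F : Type*} [MeasurableSpace Ω] [MeasurableSpace Y] [MeasurableSpace F]

/-- The `L¹` distance to an average is at most the average of the `L¹` distances. -/
theorem lintegral_enorm_sub_average_le {ν : Measure Ω} [IsFiniteMeasure ν] {lam : Measure Y}
    [SFinite lam] {p : Ω → Y → ℝ} (hp : Measurable fun w : Ω × Y => p w.1 w.2)
    (hp1 : ∀ x, ∫⁻ y, ‖p x y‖ₑ ∂lam ≤ 1) {f : Y → ℝ} (hf : Measurable f) (hν : ν ≠ 0) :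
    ∫⁻ y, ‖f y - ⨍ x, p x y ∂ν‖ₑ ∂lam ≤ ⨍⁻ x, ∫⁻ y, ‖f y - p x y‖ₑ ∂lam ∂ν := by
  have : NeZero ν := ⟨hν⟩
  simp only [average, laverage]
  set ρ := (ν univ)⁻¹ • ν with hρ
  have hm : Measurable fun w : Ω × Y => ‖f w.2 - p w.1 w.2‖ₑ :=
    ((hf.comp measurable_snd).sub hp).enorm
  rw [lintegral_lintegral_swap hm.aemeasurable]
  -- This makes `p · y` integrable for almost every `y`, so that the average is not the default
  -- value 0 and `f y` can be moved under the integral.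
  have h1 : ∫⁻ y, ∫⁻ x, ‖p x y‖ₑ ∂ρ ∂lam ≤ 1 := by
    rw [lintegral_lintegral_swap (f := fun y x => ‖p x y‖ₑ)
      (hp.enorm.comp measurable_swap).aemeasurable]
    calc _ ≤ ∫⁻ x, 1 ∂ρ := lintegral_mono hp1
      _ = 1 := by simp
  have h2 : ∀ᵐ y ∂lam, ∫⁻ x, ‖p x y‖ₑ ∂ρ < ∞ :=
    ae_lt_top (Measurable.lintegral_prod_left' hp.enorm) (h1.trans_lt ENNReal.one_lt_top).ne
  refine lintegral_mono_ae ?_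
  filter_upwards [h2] with y hy
  have hint : Integrable (fun x => p x y) ρ :=
    ⟨(hp.comp measurable_prodMk_right).aestronglyMeasurable, hy⟩
  have : f y - ∫ x, p x y ∂ρ = ∫ x, (f y - p x y) ∂ρ := by
    rw [integral_sub (integrable_const _) hint]
    simp
  rw [this]
  exact enorm_integral_le_lintegral_enorm _

theorem ProbabilityTheory.Kernel.measurable_average (κ : Kernel F Ω) {p : Ω → Y → ℝ}
    (hp : Measurable fun w : Ω × Y => p w.1 w.2) :
    Measurable fun w : F × Y => ⨍ x, p x w.2 ∂κ w.1 := by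
  let ρ : Kernel F Ω := ⟨fun z => (κ z univ)⁻¹ • κ z, by
    refine Measure.measurable_of_measurable_coe _ fun s hs => ?_
    simp only [Measure.smul_apply, smul_eq_mul]
    exact (κ.measurable_coe MeasurableSet.univ).inv.mul (κ.measurable_coe hs)⟩
  have hρ : IsFiniteKernel ρ := ⟨1, ENNReal.one_lt_top, fun z => by
    change (κ z univ)⁻¹ * κ z univ ≤ 1
    exact ENNReal.inv_mul_le_one _⟩
  have : StronglyMeasurable fun v : (F × Y) × Ω => p v.2 v.1.2 :=
    (hp.comp (measurable_snd.prodMk (measurable_snd.comp measurable_fst))).stronglyMeasurable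
  exact (this.integral_kernel_prod_right' (κ := ρ.prodMkRight Y)).measurable

end Average

/-! ### Lumpability and differential lumpability -/

namespace ReactionCoordinate

open Measure Set

variable {n r : ℕ} {X : Set (EuclideanSpace ℝ (Fin n))}

namespace MarkovSystem

theorem lintegral_density (S : MarkovSystem X) {t : ℝ} (ht : 0 < t) (x : X) :
    ∫⁻ y, ENNReal.ofReal (S.p t x y) ∂leb X = 1 := by
  have := S.markov t ht
  have h1 : S.P t x univ = 1 := measure_univ
  rwa [S.p_density t ht, withDensity_apply _ MeasurableSet.univ, Measure.restrict_univ] at h1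

theorem measurable_p_right (S : MarkovSystem X) {t : ℝ} (ht : 0 < t) (x : X) :
    Measurable (S.p t x) := (S.p_measurable t ht).comp measurable_prodMk_left

theorem enorm_p (S : MarkovSystem X) {t : ℝ} (ht : 0 < t) (x y : X) :
    ‖S.p t x y‖ₑ = ENNReal.ofReal (S.p t x y) := by
  rw [Real.enorm_eq_ofReal_abs, abs_of_nonneg (S.p_nonneg t ht x y)]

theorem dist_eq (S : MarkovSystem X) (t : ℝ) (x₁ x₂ : X) :
    S.dist t x₁ x₂ = ∫⁻ y, ‖S.p t x₁ y - S.p t x₂ y‖ₑ ∂leb X := by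
  rw [MarkovSystem.dist, eLpNorm_one_eq_lintegral_enorm]

theorem dist_comm (S : MarkovSystem X) (t : ℝ) (x₁ x₂ : X) :
    S.dist t x₁ x₂ = S.dist t x₂ x₁ := by
  simp_rw [dist_eq, ← enorm_neg (S.p t x₁ _ - _), neg_sub]

/-- The Chapman-Kolmogorov equation for the densities. -/
theorem ae_chapman_kolmogorov (hX : NullMeasurableSet X volume) (S : MarkovSystem X) {s t : ℝ}
    (hs : 0 < s) (ht : 0 < t) (x : X) :
    ∀ᵐ y ∂leb X, ENNReal.ofReal (S.p (s + t) x y) =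
      ∫⁻ w, ENNReal.ofReal (S.p s x w) * ENNReal.ofReal (S.p t w y) ∂leb X := by
  have := sigmaFinite_leb hX
  have hjm : Measurable fun v : X × X => ENNReal.ofReal (S.p s x v.1) *
      ENNReal.ofReal (S.p t v.1 v.2) :=
    ((S.measurable_p_right hs x).comp measurable_fst).ennreal_ofReal.mul
      (S.p_measurable t ht).ennreal_ofReal
  have hm : Measurable fun y => ∫⁻ w, ENNReal.ofReal (S.p s x w) *
      ENNReal.ofReal (S.p t w y) ∂leb X := hjm.lintegral_prod_left'
  refine (withDensity_eq_iff_of_sigmaFinite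
    (S.measurable_p_right (add_pos hs ht) x).ennreal_ofReal.aemeasurable hm.aemeasurable).1 ?_
  rw [← S.p_density _ (add_pos hs ht), S.chapman_kolmogorov s t hs ht]
  ext A hA
  rw [Kernel.comp_apply' _ _ _ hA, withDensity_apply _ hA, S.p_density s hs,
    lintegral_withDensity_eq_lintegral_mul _ (S.measurable_p_right hs x).ennreal_ofReal
      ((S.P t).measurable_coe hA), lintegral_lintegral_swap
      (f := fun y w => ENNReal.ofReal (S.p s x w) * ENNReal.ofReal (S.p t w y))
      (hjm.comp measurable_swap).aemeasurable]
  refine lintegral_congr fun w => ?_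
  rw [lintegral_const_mul _ (S.measurable_p_right ht w).ennreal_ofReal, Pi.mul_apply,
    S.p_density t ht, withDensity_apply _ hA]

/-- The transition operators contract `L¹`. -/
theorem dist_antitone (hX : NullMeasurableSet X volume) (S : MarkovSystem X) {s t : ℝ}
    (hs : 0 < s) (hst : s ≤ t) (x₁ x₂ : X) : S.dist t x₁ x₂ ≤ S.dist s x₁ x₂ := by
  rcases hst.eq_or_lt with rfl | hst
  · exact le_rfl
  have := sigmaFinite_leb hX
  obtain ⟨u, hu, rfl⟩ : ∃ u, 0 < u ∧ t = s + u := ⟨t - s, sub_pos.2 hst, by ring⟩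
  have hdm : Measurable fun w => ‖S.p s x₁ w - S.p s x₂ w‖ₑ :=
    ((S.measurable_p_right hs x₁).sub (S.measurable_p_right hs x₂)).enorm
  -- A one-sided bound in additive form avoids subtraction in `ℝ≥0∞`; exchanging `a` and `b` then
  -- bounds the absolute value.
  have key : ∀ a b : X, ∀ᵐ y ∂leb X, ENNReal.ofReal (S.p (s + u) a y) ≤
      ENNReal.ofReal (S.p (s + u) b y) +
      ∫⁻ w, ‖S.p s a w - S.p s b w‖ₑ * ENNReal.ofReal (S.p u w y) ∂leb X := by
    intro a b
    filter_upwards [S.ae_chapman_kolmogorov hX hs hu a, S.ae_chapman_kolmogorov hX hs hu b]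
      with y ha hb
    have hpy : Measurable fun w => S.p u w y :=
      (S.p_measurable u hu).comp measurable_prodMk_right
    rw [ha, hb]
    refine le_trans (lintegral_mono fun w => ?_) (lintegral_add_left
      ((S.measurable_p_right hs b).ennreal_ofReal.mul hpy.ennreal_ofReal) _).le
    rw [Pi.mul_apply, ← add_mul]
    gcongr
    rw [Real.enorm_eq_ofReal_abs, ← ENNReal.ofReal_add (S.p_nonneg s hs b w) (abs_nonneg _)]
    refine ENNReal.ofReal_le_ofReal ?_
    linarith [le_abs_self (S.p s a w - S.p s b w)]
  have hpt : ∀ᵐ y ∂leb X, ‖S.p (s + u) x₁ y - S.p (s + u) x₂ y‖ₑ ≤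
      ∫⁻ w, ‖S.p s x₁ w - S.p s x₂ w‖ₑ * ENNReal.ofReal (S.p u w y) ∂leb X := by
    filter_upwards [key x₁ x₂, key x₂ x₁] with y h1 h2
    have h3 : ∀ w, ‖S.p s x₂ w - S.p s x₁ w‖ₑ = ‖S.p s x₁ w - S.p s x₂ w‖ₑ := fun w => by
      rw [← enorm_neg, neg_sub]
    simp_rw [h3] at h2
    rw [Real.enorm_eq_ofReal_abs]
    rcases abs_cases (S.p (s + u) x₁ y - S.p (s + u) x₂ y) with ⟨h, -⟩ | ⟨h, -⟩
    · rw [h, ENNReal.ofReal_sub _ (S.p_nonneg _ (add_pos hs hu) _ _)]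
      exact tsub_le_iff_left.2 h1
    · rw [h, neg_sub, ENNReal.ofReal_sub _ (S.p_nonneg _ (add_pos hs hu) _ _)]
      exact tsub_le_iff_left.2 h2
  rw [dist_eq, dist_eq]
  refine (lintegral_mono_ae hpt).trans ?_
  have hjm : Measurable fun v : X × X => ‖S.p s x₁ v.1 - S.p s x₂ v.1‖ₑ *
      ENNReal.ofReal (S.p u v.1 v.2) :=
    (hdm.comp measurable_fst).mul (S.p_measurable u hu).ennreal_ofReal
  rw [lintegral_lintegral_swap
    (f := fun y w => ‖S.p s x₁ w - S.p s x₂ w‖ₑ * ENNReal.ofReal (S.p u w y))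
    (hjm.comp measurable_swap).aemeasurable]
  refine (lintegral_congr fun w => ?_).le
  rw [lintegral_const_mul _ (S.measurable_p_right hu w).ennreal_ofReal,
    S.lintegral_density hu, mul_one]

theorem isDisintegration (hX : NullMeasurableSet X volume) (S : MarkovSystem X)
    {Z : Set (EuclideanSpace ℝ (Fin r))}
    {ξ : EuclideanSpace ℝ (Fin n) → EuclideanSpace ℝ (Fin r)} (hξ : IsReactionCoordinate X Z ξ) :
    IsDisintegration volume S.mu (fun x : X => ξ x) (S.levelMeasure ξ) where
  measurable := hξ.continuous_comp_coe.measurable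
  ae_fiber := S.ae_levelMeasure hξ
  aemeasurable_lintegral _ hG := (S.disintegration hX hξ hG).1
  lintegral_lintegral _ hG := (S.disintegration hX hξ hG).2

theorem levelMeasure_of_notMem (S : MarkovSystem X) {Z : Set (EuclideanSpace ℝ (Fin r))}
    {ξ : EuclideanSpace ℝ (Fin n) → EuclideanSpace ℝ (Fin r)} (hξ : IsReactionCoordinate X Z ξ)
    {z : EuclideanSpace ℝ (Fin r)} (hz : z ∉ Z) : S.levelMeasure ξ z = 0 := by
  have : levelSet X ξ z = ∅ :=
    eq_empty_of_forall_notMem fun x hx => hz (by rw [← show ξ x = z from hx]; exact hξ.mapsTo x.2)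
  simp [levelMeasure, this]

/-- Level sets over points outside `Z` are empty, so the disintegration over all of ℝʳ can be used
for integrals over `Z`. -/
theorem setLIntegral_levelMeasure (S : MarkovSystem X) {Z : Set (EuclideanSpace ℝ (Fin r))}
    (hZ : MeasurableSet Z) {ξ : EuclideanSpace ℝ (Fin n) → EuclideanSpace ℝ (Fin r)}
    (hξ : IsReactionCoordinate X Z ξ) (G : EuclideanSpace ℝ (Fin r) → X → ℝ≥0∞) :
    ∫⁻ z in Z, ∫⁻ x, G z x ∂S.levelMeasure ξ z = ∫⁻ z, ∫⁻ x, G z x ∂S.levelMeasure ξ z := by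
  rw [← lintegral_indicator hZ]
  refine lintegral_congr fun z => ?_
  by_cases hz : z ∈ Z
  · simp [hz]
  · simp [hz, S.levelMeasure_of_notMem hξ hz]

/-- Lumpability at one time implies differential lumpability with the doubled constant. -/
theorem IsLumpableAt.isDifferentiallyLumpableAvg (hX : NullMeasurableSet X volume)
    {S : MarkovSystem X} {Z : Set (EuclideanSpace ℝ (Fin r))} (hZ : MeasurableSet Z)
    {ξ : EuclideanSpace ℝ (Fin n) → EuclideanSpace ℝ (Fin r)} (hξ : IsReactionCoordinate X Z ξ)
    {τ : ℝ} (hτ : 0 < τ) {ε : ℝ} (h : S.IsLumpableAt Z ξ τ ε) :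
    S.IsDifferentiallyLumpableAvg Z ξ τ (2 * ε) := by
  obtain ⟨q, -, hqm, hq⟩ := h
  have := sigmaFinite_leb hX
  have hprob : IsProbabilityMeasure S.mu := S.prob
  have hdis := S.isDisintegration hX hξ
  have hpq : AEStronglyMeasurable (fun w : X × X => S.p τ w.1 w.2 - q (ξ w.1) w.2)
      (S.mu.prod (leb X)) := (S.p_measurable τ hτ).aestronglyMeasurable.sub hqm
  rw [eLpNorm_one_eq_lintegral_enorm, lintegral_prod _ hpq.enorm] at hq
  have hFm : AEMeasurable (fun x => ∫⁻ y, ‖S.p τ x y - q (ξ x) y‖ₑ ∂leb X) S.mu :=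
    hpq.enorm.lintegral_prod_right'
  -- The function `q` is measurable only up to null sets, so the inner integral is replaced by a
  -- measurable version, which agrees with it at `μ_z`-almost every point for almost every `z`.
  have hgood : ∀ᵐ x : X ∂S.mu, AEStronglyMeasurable (fun y => q (ξ x) y) (leb X) ∧
      ∫⁻ y, ‖S.p τ x y - q (ξ x) y‖ₑ ∂leb X = hFm.mk _ x :=
    (AEStronglyMeasurable.prodMk_left hqm).and hFm.ae_eq_mk
  have hmain : ∀ᵐ z, ∫⁻ x₂, ⨍⁻ x₁, S.dist τ x₁ x₂ ∂(S.levelMeasure ξ z) ∂(S.levelMeasure ξ z) ≤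
      2 * ∫⁻ x, hFm.mk _ x ∂(S.levelMeasure ξ z) := by
    filter_upwards [hdis.ae_ae hgood, hdis.ae_isFiniteMeasure] with z hz hfin
    refine lintegral_laverage_le_two_mul hFm.measurable_mk ?_
    filter_upwards [hz, S.ae_levelMeasure hξ z] with x₂ hx₂ hxz₂
    filter_upwards [hz, S.ae_levelMeasure hξ z] with x₁ hx₁ hxz₁
    have hqs := hx₂.1
    rw [← hx₁.2, ← hx₂.2, S.dist_eq, hxz₁, hxz₂]
    rw [hxz₂] at hqs
    refine le_trans (lintegral_mono fun y => ?_) (lintegral_add_left'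
      ((S.measurable_p_right hτ x₁).aestronglyMeasurable.sub hqs).enorm _).le
    calc _ = ‖(S.p τ x₁ y - q z y) - (S.p τ x₂ y - q z y)‖ₑ := by congr 1; ring
      _ ≤ _ := enorm_sub_le
  rw [IsDifferentiallyLumpableAvg, S.setLIntegral_levelMeasure hZ hξ]
  calc _ ≤ (volume Z)⁻¹ * ∫⁻ z, 2 * ∫⁻ x, hFm.mk _ x ∂(S.levelMeasure ξ z) := by
        gcongr 1
        exact lintegral_mono_ae hmain
    _ = 2 * ((volume Z)⁻¹ * ∫⁻ x, ∫⁻ y, ‖S.p τ x y - q (ξ x) y‖ₑ ∂leb X ∂S.mu) := by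
        rw [lintegral_const_mul' _ _ (by simp), hdis.lintegral_lintegral _ hFm.measurable_mk,
          ← lintegral_congr_ae hFm.ae_eq_mk]
        ring
    _ ≤ 2 * ENNReal.ofReal ε := by gcongr
    _ = _ := by rw [ENNReal.ofReal_mul zero_le_two]; simp

theorem IsLumpableWith.congr {S : MarkovSystem X} {Z : Set (EuclideanSpace ℝ (Fin r))}
    {ξ : EuclideanSpace ℝ (Fin n) → EuclideanSpace ℝ (Fin r)} (hX : NullMeasurableSet X volume)
    {t ε : ℝ} {q q' : EuclideanSpace ℝ (Fin r) → X → ℝ} (h : S.IsLumpableWith Z ξ t ε q)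
    (hq' : ∀ z ∈ Z, ∀ y, 0 ≤ q' z y) (hqq : ∀ᵐ x : X ∂S.mu, q (ξ x) = q' (ξ x)) :
    S.IsLumpableWith Z ξ t ε q' := by
  have := sigmaFinite_leb hX
  have hprob : IsProbabilityMeasure S.mu := S.prob
  have hae : ∀ᵐ w ∂S.mu.prod (leb X), q (ξ w.1) w.2 = q' (ξ w.1) w.2 := by
    filter_upwards [Measure.quasiMeasurePreserving_fst.ae hqq] with w hw
    rw [hw]
  refine ⟨hq', h.2.1.congr hae, ?_⟩
  rw [← eLpNorm_congr_ae (f := fun w : X × X => S.p t w.1 w.2 - q (ξ w.1) w.2)]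
  · exact h.2.2
  · filter_upwards [hae] with w hw
    rw [hw]

theorem average_p_nonneg (S : MarkovSystem X) {t : ℝ} (ht : 0 < t) (ν : Measure X) (y : X) :
    0 ≤ ⨍ x, S.p t x y ∂ν := integral_nonneg fun x => S.p_nonneg t ht x y

theorem measurable_average_comp (S : MarkovSystem X) {t : ℝ} (ht : 0 < t) {F : Type*}
    [MeasurableSpace F] (κ : Kernel F X) {f : X → F} (hf : Measurable f) :
    Measurable fun w : X × X => ⨍ x', S.p t x' w.2 ∂κ (f w.1) := by
  have h1 := κ.measurable_average (p := S.p t) (S.p_measurable t ht)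
  have h2 : Measurable fun w : X × X => (f w.1, w.2) :=
    (hf.comp measurable_fst).prodMk measurable_snd
  simpa only [Function.comp_def] using h1.comp h2

/-- Differential lumpability implies lumpability through the averaged densities. -/
theorem IsDifferentiallyLumpableAvg.isLumpableThrough (hX : NullMeasurableSet X volume)
    {S : MarkovSystem X} {Z : Set (EuclideanSpace ℝ (Fin r))} (hZ : MeasurableSet Z)
    {ξ : EuclideanSpace ℝ (Fin n) → EuclideanSpace ℝ (Fin r)} (hξ : IsReactionCoordinate X Z ξ)
    {τ : ℝ} (hτ : 0 < τ) {ε : ℝ} (h : S.IsDifferentiallyLumpableAvg Z ξ τ ε) :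
    S.IsLumpableThrough Z ξ τ ε fun t z y => ⨍ x', S.p t x' y ∂(S.levelMeasure ξ z) := by
  intro t hτt
  have ht : 0 < t := hτ.trans_le hτt
  have := sigmaFinite_leb hX
  have hprob : IsProbabilityMeasure S.mu := S.prob
  have hdis := S.isDisintegration hX hξ
  obtain ⟨κ, hκf, hκ⟩ := hdis.exists_kernel
  have hpm := S.p_measurable t ht
  have hqm : Measurable fun w : X × X => ⨍ x', S.p t x' w.2 ∂κ (ξ w.1) :=
    by simpa only using S.measurable_average_comp ht κ hdis.measurable
  -- The kernel supplies joint measurability; its averages agree with those of `μ_z` at `z = ξ x`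
  -- for `μ`-almost every `x`.
  suffices hs : S.IsLumpableWith Z ξ t ε fun z y => ⨍ x', S.p t x' y ∂κ z by
    refine hs.congr hX (fun z _ y => S.average_p_nonneg ht _ y) ?_
    filter_upwards [hdis.ae_comp hκ] with x hx
    rw [hx]
  refine ⟨fun z _ y => S.average_p_nonneg ht _ y, hqm.aestronglyMeasurable, ?_⟩
  have hpq : Measurable fun w : X × X => ‖S.p t w.1 w.2 - ⨍ x', S.p t x' w.2 ∂κ (ξ w.1)‖ₑ :=
    (hpm.sub hqm).enorm
  rw [eLpNorm_one_eq_lintegral_enorm, lintegral_prod _ hpq.aemeasurable,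
    ← hdis.lintegral_lintegral _ hpq.lintegral_prod_right']
  rw [IsDifferentiallyLumpableAvg, S.setLIntegral_levelMeasure hZ hξ] at h
  refine le_trans ?_ h
  gcongr 1
  refine lintegral_mono_ae ?_
  filter_upwards [hκ] with z hz
  rw [hz]
  rcases eq_or_ne (κ z) 0 with h0 | h0
  · simp [h0]
  refine lintegral_mono_ae ?_
  have hfib := S.ae_levelMeasure hξ z
  rw [hz] at hfib
  filter_upwards [hfib] with x₂ hx₂
  rw [hx₂]
  refine (lintegral_enorm_sub_average_le hpm (fun x => ?_) (S.measurable_p_right ht x₂) h0).trans ?_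
  · simp_rw [S.enorm_p ht]
    exact (S.lintegral_density ht x).le
  · refine lintegral_mono fun x₁ => ?_
    rw [← S.dist_eq, S.dist_comm]
    -- The hypothesis concerns time `τ` only; the L¹ contraction carries it to every `t ≥ τ`.
    exact S.dist_antitone hX hτ hτt x₁ x₂

theorem isDifferentiallyLumpable_iff_avg (S : MarkovSystem X)
    {Z : Set (EuclideanSpace ℝ (Fin r))}
    {ξ : EuclideanSpace ℝ (Fin n) → EuclideanSpace ℝ (Fin r)}
    (h : ∀ᵐ z ∂(volume.restrict Z), IsProbabilityMeasure (S.levelMeasure ξ z)) (τ ε : ℝ) :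
    S.IsDifferentiallyLumpable Z ξ τ ε ↔ S.IsDifferentiallyLumpableAvg Z ξ τ ε := by
  rw [IsDifferentiallyLumpable, IsDifferentiallyLumpableAvg]
  have : ∫⁻ z in Z, ∫⁻ x₂, ∫⁻ x₁, S.dist τ x₁ x₂ ∂(S.levelMeasure ξ z) ∂(S.levelMeasure ξ z) =
      ∫⁻ z in Z, ∫⁻ x₂, ⨍⁻ x₁, S.dist τ x₁ x₂ ∂(S.levelMeasure ξ z) ∂(S.levelMeasure ξ z) := by
    refine lintegral_congr_ae ?_
    filter_upwards [h] with z hz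
    simp only [laverage_eq_lintegral]
  rw [this]

end MarkovSystem

end ReactionCoordinate

theorem mainTheorem6 {n r : ℕ} (hr : r ≤ n)
    {X : Set (EuclideanSpace ℝ (Fin n))} (hX : NullMeasurableSet X volume)
    (S : ReactionCoordinate.MarkovSystem X)
    {Z : Set (EuclideanSpace ℝ (Fin r))} (hZ : MeasurableSet Z)
    {ξ : EuclideanSpace ℝ (Fin n) → EuclideanSpace ℝ (Fin r)}
    (hξ : ReactionCoordinate.IsReactionCoordinate X Z ξ)
    {τ : ℝ} (hτ : 0 < τ) {ε : ℝ} (hε : 0 ≤ ε) :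
    -- the marginal stationary measures are probability measures
    ((∀ᵐ z ∂(volume.restrict Z), IsProbabilityMeasure (S.levelMeasure ξ z)) →
      (S.IsLumpableAt Z ξ τ ε → S.IsDifferentiallyLumpable Z ξ τ (2 * ε)) ∧
      (S.IsDifferentiallyLumpable Z ξ τ ε →
        S.IsLumpableThrough Z ξ τ ε
          fun t z y => ∫ x', S.p t x' y ∂(S.levelMeasure ξ z))) ∧
    -- marginal stationary measures of arbitrary total mass
    (S.IsLumpableAt Z ξ τ ε → S.IsDifferentiallyLumpableAvg Z ξ τ (2 * ε)) ∧
    (S.IsDifferentiallyLumpableAvg Z ξ τ ε →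
      S.IsLumpableThrough Z ξ τ ε
        fun t z y => ⨍ x', S.p t x' y ∂(S.levelMeasure ξ z)) := by
  refine ⟨fun hprob => ⟨fun h => ?_, fun h t ht => ?_⟩,
    fun h => h.isDifferentiallyLumpableAvg hX hZ hξ hτ,
    fun h => h.isLumpableThrough hX hZ hξ hτ⟩
  · exact (S.isDifferentiallyLumpable_iff_avg hprob _ _).2
      (h.isDifferentiallyLumpableAvg hX hZ hξ hτ)
  · have h1 := ((S.isDifferentiallyLumpable_iff_avg hprob _ _).1 h).isLumpableThrough
      hX hZ hξ hτ t ht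
    refine h1.congr hX
      (fun z _ y => integral_nonneg fun x => S.p_nonneg t (hτ.trans_le ht) x y) ?_
    -- For `μ`-almost every `x` the measure on the level set through `x` is a probability measure,
    -- so integral and average give the same density there.
    have h2 := (S.isDisintegration hX hξ).ae_comp ((ae_restrict_iff' hZ).1 hprob)
    filter_upwards [h2] with x hx
    have := hx (hξ.mapsTo x.2)
    simp only [average_eq_integral]
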